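/- Let $f:\mathbb{R}^2\to\mathbb{R}$ be a polynomial function with $f(0,0)=0$ that has a strict local minimum at the origin, and let $V$ be a neighbourhood of the origin. For $\varepsilon>0$ let $\mathcal{D}_\varepsilon$ be the connected component of $f^{-1}([0,\varepsilon])$ that contains the origin, and let $\mathcal{C}_\varepsilon=\mathcal{D}_\varepsilon\setminus\operatorname{Int}\mathcal{D}_\varepsilon$, where $\operatorname{Int}$ denotes the topological interior. Then there exists $\varepsilon_0>0$ such that, for every $0<\varepsilon<\varepsilon_0$: - $\mathcal{C}_\varepsilon$ is a Jordan curve, that is, the image of a continuous map $\gamma:[a,b]\to\mathbb{R}^2$ with $a<b$, $\gamma(a)=\gamma(b)$ and $\gamma$ injective on $[a,b)$; - $\mathcal{C}_\varepsilon$ is diffeomorphic to the unit circle $S^1$; - $\mathcal{D}_\varepsilon$ is diffeomorphic to the closed unit disk, and $\mathcal{D}_\varepsilon\subseteq V$; - $\mathbb{R}^2\setminus\mathcal{C}_\varepsilon$ has exactly one bounded connected component, and this component contains the origin. Here subsets $X,Y\subseteq\mathbb{R}^2$ are called diffeomorphic if there is a bijection $X\to Y$ such that it and its inverse are smooth, a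 map on $X$ being smooth if near each point of $X$ it is the restriction of a $C^\infty$ map defined on an open subset of $\mathbb{R}^2$. -/

import Mathlib

open scoped Topology ContDiff

namespace LevelCurves

/-- The real affine plane with its Euclidean norm. -/
abbrev Plane : Type := EuclideanSpace ℝ (Fin 2)

/-- The polynomial function on the plane defined by a real bivariate polynomial. -/
noncomputable def polyFun (P : MvPolynomial (Fin 2) ℝ) (p : Plane) : ℝ :=
  MvPolynomial.eval (fun i => p i) P

/-- `f` has a strict local minimum at `p`: `f p < f q` for all `q ≠ p` close to `p`. -/
def IsStrictLocalMin (f : Plane → ℝ) (p : Plane) : Prop :=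
  ∀ᶠ q in 𝓝[≠] p, f p < f q

/-- The connected component containing the origin of the set of points where `0 ≤ f ≤ ε`. -/
def levelDisk (f : Plane → ℝ) (ε : ℝ) : Set Plane :=
  connectedComponentIn (f ⁻¹' Set.Icc 0 ε) 0

/-- The level curve: the points of `levelDisk f ε` that are not in its topological interior. -/
def levelCurve (f : Plane → ℝ) (ε : ℝ) : Set Plane :=
  levelDisk f ε \ interior (levelDisk f ε)

/-- A Jordan curve in the plane: the image of a closed interval `[a, b]`, `a < b`, under a
continuous map taking the same value at `a` and `b` and injective on `[a, b)`. -/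
def IsJordanCurve (J : Set Plane) : Prop :=
  ∃ (a b : ℝ) (γ : ℝ → Plane), a < b ∧ ContinuousOn γ (Set.Icc a b) ∧ γ a = γ b ∧
    Set.InjOn γ (Set.Ico a b) ∧ γ '' Set.Icc a b = J

/-- Smoothness of a map on an arbitrary subset `X` of the plane: near every point of `X` the map
agrees on `X` with a `C^∞` map defined on an open subset of the plane. -/
def SmoothOnSubset (g : Plane → Plane) (X : Set Plane) : Prop :=
  ∀ x ∈ X, ∃ (U : Set Plane) (G : Plane → Plane), IsOpen U ∧ x ∈ U ∧
    ContDiffOn ℝ ∞ G U ∧ Set.EqOn G g (U ∩ X)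

/-- Two subsets of the plane are diffeomorphic: there is a bijection between them that is smooth
and whose inverse is smooth. Only the values of `g` on `X` and of `h` on `Y` matter. -/
def Diffeomorphic (X Y : Set Plane) : Prop :=
  ∃ g h : Plane → Plane, Set.MapsTo g X Y ∧ Set.MapsTo h Y X ∧ Set.InvOn h g X Y ∧
    SmoothOnSubset g X ∧ SmoothOnSubset h Y

/-- The set of bounded connected components of the complement of `J`. -/
def boundedComplementComponents (J : Set Plane) : Set (Set Plane) :=
  {B | Bornology.IsBounded B ∧ ∃ x ∈ Jᶜ, B = connectedComponentIn Jᶜ x}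

end LevelCurves

namespace LevelCurves

/-! The heart of the matter is that, near the origin, the gradient of `P` neither vanishes nor
points towards the origin (`eventually_polyGrad_combination_ne_zero`). The gradient is radial
exactly on the algebraic set `rotDeriv P = 0`, so it suffices that `eulerDeriv P` is positive there
(`eventually_eulerDeriv_pos`). This is checked on each irreducible factor `q` of `rotDeriv P`.
Either `q` divides `rotDeriv q`, and then `q` has no zeros near the origin other than the origin
itself; or the curve `q = 0` crosses circles transversally, and a point with `eulerDeriv P ≤ 0`
could be slid along it towards the origin without decreasing `P`. A compactness argument forbids
this, since `P` is positive at the point and zero at the origin.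

Given this, the bottom of `P` is replaced by a small paraboloid (`roundedBottom`) without creating
critical points or changing the sublevel set `P ≤ ε`. A vector field multiplying the new function
infinitesimally by `2` then has a flow that shrinks this sublevel set to a round disk
(`exists_diffeo_of_scaling`). The flow is a diffeomorphism of the whole plane, so all the assertions
are carried over from the unit disk. -/

/-! ### Elimination: common zeros of coprime bivariate polynomials are isolated. -/

open Polynomial in
/-- If `q` is irreducible and does not divide `k` in `R[X]`, `R` a normalized GCD domain, then the
ideal `(q, k)` contains a nonzero constant. -/
lemma exists_combination_eq_C_of_irreducible {R : Type*} [CommRing R] [IsDomain R]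
    [NormalizedGCDMonoid R] {q k : R[X]} (hq : Irreducible q) (hk : ¬ q ∣ k) :
    ∃ r : R, r ≠ 0 ∧ ∃ a b : R[X], a * q + b * k = C r := by
  by_cases hdeg : q.natDegree = 0
  · obtain ⟨r, hr⟩ := natDegree_eq_zero.1 hdeg
    refine ⟨r, ?_, 1, 0, by simp [hr]⟩
    rintro rfl
    exact hq.ne_zero (by simpa using hr.symm)
  -- By Gauss's lemma `q` stays irreducible over the fraction field, where Bézout applies; clearing
  -- denominators then leaves the constant `s * t`.
  have hprim : q.IsPrimitive := hq.isPrimitive hdeg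
  let K := FractionRing R
  have hirr : Irreducible (q.map (algebraMap R K)) :=
    (hprim.irreducible_iff_irreducible_map_fraction_map (K := K)).1 hq
  have hnd : ¬ q.map (algebraMap R K) ∣ k.map (algebraMap R K) := fun h =>
    hk (hprim.dvd_of_fraction_map_dvd_fraction_map h)
  obtain ⟨a, b, hab⟩ := (hirr.coprime_iff_not_dvd).2 hnd
  obtain ⟨s, hs, hs'⟩ := IsLocalization.integerNormalization_spec (nonZeroDivisors R) a
  obtain ⟨t, ht, ht'⟩ := IsLocalization.integerNormalization_spec (nonZeroDivisors R) b
  refine ⟨s * t, mul_ne_zero (nonZeroDivisors.ne_zero hs) (nonZeroDivisors.ne_zero ht),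
    C t * IsLocalization.integerNormalization (nonZeroDivisors R) a,
    C s * IsLocalization.integerNormalization (nonZeroDivisors R) b, ?_⟩
  apply map_injective _ (IsFractionRing.injective R K)
  have e1 : ∀ (x : R) (p : K[X]), x • p = C (algebraMap R K x) * p := fun x p => by
    rw [← smul_eq_C_mul, algebraMap_smul]
  simp only [e1] at hs' ht'
  simp only [Polynomial.map_add, Polynomial.map_mul, map_C, hs', ht', map_mul]
  linear_combination (C (algebraMap R K s) * C (algebraMap R K t)) * hab

/-- Bivariate polynomials as polynomials in the variable `j` over polynomials in the
variable `i`. -/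
noncomputable def bivariateEquiv (i j : Fin 2) (hij : i ≠ j) :
    MvPolynomial (Fin 2) ℝ ≃ₐ[ℝ] Polynomial (Polynomial ℝ) :=
  AlgEquiv.ofAlgHom
    (MvPolynomial.aeval fun l => if l = i then Polynomial.C Polynomial.X else Polynomial.X)
    (Polynomial.aevalAeval (MvPolynomial.X i) (MvPolynomial.X j))
    (by ext <;> simp [hij.symm])
    (by
      ext l
      by_cases h : l = i
      · simp [h]
      · have : l = j := by omega
        simp [this, hij.symm])

lemma exists_combination_eq_aeval_of_irreducible {q k : MvPolynomial (Fin 2) ℝ}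
    (hq : Irreducible q) (hk : ¬ q ∣ k) (i : Fin 2) :
    ∃ r : Polynomial ℝ, r ≠ 0 ∧ ∃ a b : MvPolynomial (Fin 2) ℝ,
      a * q + b * k = Polynomial.aeval (MvPolynomial.X i) r := by
  classical
  obtain ⟨j, hij⟩ : ∃ j : Fin 2, i ≠ j := ⟨i + 1, by fin_cases i <;> simp⟩
  let e := bivariateEquiv i j hij
  have hnorm : NormalizedGCDMonoid (Polynomial ℝ) :=
    Classical.arbitrary _
  obtain ⟨r, hr, a, b, hab⟩ := exists_combination_eq_C_of_irreducible (q := e q) (k := e k)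
    ((MulEquiv.irreducible_iff e).2 hq) (fun h => hk ((map_dvd_iff e).1 h))
  refine ⟨r, hr, e.symm a, e.symm b, ?_⟩
  apply e.injective
  simp only [map_add, map_mul, AlgEquiv.apply_symm_apply, hab]
  rw [← Polynomial.aeval_algHom_apply]
  have : e (MvPolynomial.X i) = Polynomial.C Polynomial.X := by
    simp [e, bivariateEquiv]
  rw [this]
  have h2 : (Polynomial.C : Polynomial ℝ →+* _) Polynomial.X
      = (Algebra.ofId (Polynomial ℝ) (Polynomial (Polynomial ℝ))).restrictScalars ℝ Polynomial.X := rfl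
  rw [h2, Polynomial.aeval_algHom_apply]
  simp

/-- Eliminating either variable confines each coordinate of a common zero to the finitely many roots
of a one-variable polynomial. Close to the origin the only root available is `0`. -/
lemma eventually_not_common_zero {q k : MvPolynomial (Fin 2) ℝ} (hq : Irreducible q)
    (hk : ¬ q ∣ k) :
    ∀ᶠ p in 𝓝[≠] (0 : Plane), ¬ (polyFun q p = 0 ∧ polyFun k p = 0) := by
  have key : ∀ i : Fin 2, ∀ᶠ p in 𝓝 (0 : Plane),
      polyFun q p = 0 ∧ polyFun k p = 0 → p i = 0 := by
    intro i
    obtain ⟨r, hr, a, b, hab⟩ := exists_combination_eq_aeval_of_irreducible hq hk i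
    have hfin : (r.rootSet ℝ \ {0}).Finite := (r.rootSet_finite ℝ).subset Set.sdiff_subset
    have hopen : (r.rootSet ℝ \ {0})ᶜ ∈ 𝓝 ((0 : Plane) i) :=
      hfin.isClosed.isOpen_compl.mem_nhds (by simp)
    have hcont : Continuous fun p : Plane => p i := by fun_prop
    filter_upwards [hcont.continuousAt.preimage_mem_nhds hopen] with p hp hz
    by_contra h0
    refine hp ⟨?_, h0⟩
    rw [Polynomial.mem_rootSet]
    refine ⟨hr, ?_⟩
    have := congrArg (MvPolynomial.eval fun l => p l) hab
    simp only [polyFun] at hz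
    simp only [map_add, map_mul, hz.1, hz.2, mul_zero, add_zero] at this
    have h3 : MvPolynomial.eval (fun l => p l) ((Polynomial.aeval (MvPolynomial.X i)) r)
      = Polynomial.aeval (p i) r := by
      change (MvPolynomial.aeval fun l => p l) _ = _
      rw [← Polynomial.aeval_algHom_apply]; simp
    rw [← h3]; exact this.symm
  filter_upwards [(key 0).filter_mono nhdsWithin_le_nhds,
    (key 1).filter_mono nhdsWithin_le_nhds, self_mem_nhdsWithin] with p h0 h1 hp hz
  apply hp
  ext i
  fin_cases i
  · exact h0 hz
  · exact h1 hz

/-! ### Rotational and radial derivatives, polar coordinates. -/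

open MvPolynomial in
/-- The rotational derivative `x ∂P/∂y - y ∂P/∂x`. -/
noncomputable def rotDeriv (P : MvPolynomial (Fin 2) ℝ) : MvPolynomial (Fin 2) ℝ :=
  X 0 * pderiv 1 P - X 1 * pderiv 0 P

open MvPolynomial in
/-- The Euler derivative `x ∂P/∂x + y ∂P/∂y`. -/
noncomputable def eulerDeriv (P : MvPolynomial (Fin 2) ℝ) : MvPolynomial (Fin 2) ℝ :=
  X 0 * pderiv 0 P + X 1 * pderiv 1 P

/-- The gradient of a polynomial function. -/
noncomputable def polyGrad (P : MvPolynomial (Fin 2) ℝ) (p : Plane) : Plane :=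
  !₂[polyFun (MvPolynomial.pderiv 0 P) p, polyFun (MvPolynomial.pderiv 1 P) p]

lemma contDiff_polyFun (P : MvPolynomial (Fin 2) ℝ) : ContDiff ℝ ∞ (polyFun P) := by
  unfold polyFun
  induction P using MvPolynomial.induction_on with
  | C a => simpa using contDiff_const
  | add p q hp hq => simpa using hp.add hq
  | mul_X p i hp => simpa using hp.mul (by fun_prop)

lemma continuous_polyFun (P : MvPolynomial (Fin 2) ℝ) : Continuous (polyFun P) :=
  (contDiff_polyFun P).continuous

lemma hasFDerivAt_polyFun (P : MvPolynomial (Fin 2) ℝ) (p : Plane) :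
    HasFDerivAt (polyFun P) (innerSL ℝ (polyGrad P p)) p := by
  have hX : ∀ i : Fin 2, HasFDerivAt (fun q : Plane => q i) (EuclideanSpace.proj i : Plane →L[ℝ] ℝ) p :=
    fun i => (EuclideanSpace.proj i : Plane →L[ℝ] ℝ).hasFDerivAt
  unfold polyFun
  induction P using MvPolynomial.induction_on with
  | C a =>
    have : innerSL ℝ (polyGrad (MvPolynomial.C a) p) = 0 := by
      ext v; simp [polyGrad, polyFun, PiLp.inner_apply]
    rw [this]
    simpa using hasFDerivAt_const (𝕜 := ℝ) a p
  | add P Q hP hQ =>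
    have : innerSL ℝ (polyGrad (P + Q) p) = innerSL ℝ (polyGrad P p) + innerSL ℝ (polyGrad Q p) := by
      ext v; simp [polyGrad, polyFun, PiLp.inner_apply]; ring
    rw [this]
    convert! hP.add hQ using 1
    ext q; simp
  | mul_X P i hP =>
    have : innerSL ℝ (polyGrad (P * MvPolynomial.X i) p)
        = polyFun P p • (EuclideanSpace.proj i : Plane →L[ℝ] ℝ) + p i • innerSL ℝ (polyGrad P p) := by
      ext v
      fin_cases i <;> simp [polyGrad, polyFun, PiLp.inner_apply, MvPolynomial.pderiv_X] <;> ring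
    rw [this]
    simpa using! hP.mul (hX i)

lemma polyFun_rotDeriv (P : MvPolynomial (Fin 2) ℝ) (p : Plane) :
    polyFun (rotDeriv P) p = p 0 * polyGrad P p 1 - p 1 * polyGrad P p 0 := by
  simp [rotDeriv, polyFun, polyGrad]

lemma polyFun_eulerDeriv (P : MvPolynomial (Fin 2) ℝ) (p : Plane) :
    polyFun (eulerDeriv P) p = inner ℝ (polyGrad P p) p := by
  simp [eulerDeriv, polyFun, polyGrad, PiLp.inner_apply]

lemma polyFun_mul (P Q : MvPolynomial (Fin 2) ℝ) (p : Plane) :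
    polyFun (P * Q) p = polyFun P p * polyFun Q p := by
  simp [polyFun]

lemma norm_sq_eq_coord (p : Plane) : ‖p‖ ^ 2 = p 0 ^ 2 + p 1 ^ 2 := by
  simp [EuclideanSpace.norm_sq_eq]

/-- The point with polar coordinates `(ρ, θ)`. -/
noncomputable def polarPoint (ρ θ : ℝ) : Plane := !₂[ρ * Real.cos θ, ρ * Real.sin θ]

lemma norm_polarPoint {ρ : ℝ} (hρ : 0 ≤ ρ) (θ : ℝ) : ‖polarPoint ρ θ‖ = ρ := by
  rw [← sq_eq_sq₀ (norm_nonneg _) hρ, norm_sq_eq_coord]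
  simp [polarPoint]
  linear_combination ρ ^ 2 * Real.sin_sq_add_cos_sq θ

lemma exists_eq_polarPoint (p : Plane) : ∃ θ, p = polarPoint ‖p‖ θ := by
  have hn : ‖(⟨p 0, p 1⟩ : ℂ)‖ = ‖p‖ := by
    rw [← sq_eq_sq₀ (norm_nonneg _) (norm_nonneg _), norm_sq_eq_coord, ← Complex.normSq_eq_norm_sq,
      Complex.normSq_mk]
    ring
  refine ⟨Complex.arg ⟨p 0, p 1⟩, ?_⟩
  ext i
  fin_cases i
  · have := Complex.norm_mul_cos_arg ⟨p 0, p 1⟩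
    rw [hn] at this
    simpa [polarPoint] using this.symm
  · have := Complex.norm_mul_sin_arg ⟨p 0, p 1⟩
    rw [hn] at this
    simpa [polarPoint] using this.symm

lemma hasDerivAt_polarPoint (ρ θ : ℝ) :
    HasDerivAt (polarPoint ρ) (!₂[-(ρ * Real.sin θ), ρ * Real.cos θ]) θ := by
  rw [hasDerivAt_iff_hasFDerivAt, ← hasFDerivWithinAt_univ, hasFDerivWithinAt_euclidean]
  intro i
  rw [hasFDerivWithinAt_univ]
  fin_cases i
  · have := (Real.hasDerivAt_cos θ).const_mul ρ
    rw [hasDerivAt_iff_hasFDerivAt] at this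
    convert! this using 1
    ext; simp
  · have := (Real.hasDerivAt_sin θ).const_mul ρ
    rw [hasDerivAt_iff_hasFDerivAt] at this
    convert! this using 1

lemma hasDerivAt_polyFun_polarPoint (P : MvPolynomial (Fin 2) ℝ) (ρ θ : ℝ) :
    HasDerivAt (fun t => polyFun P (polarPoint ρ t)) (polyFun (rotDeriv P) (polarPoint ρ θ)) θ := by
  have := (hasFDerivAt_polyFun P (polarPoint ρ θ)).comp_hasDerivAt θ (hasDerivAt_polarPoint ρ θ)
  convert! this using 1
  rw [polyFun_rotDeriv]
  simp [polarPoint, PiLp.inner_apply]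
  ring

/-- If `q` divides its rotational derivative then its zero set is invariant under rotations. -/
lemma polyFun_eq_zero_of_norm_eq {q : MvPolynomial (Fin 2) ℝ} (hq : q ∣ rotDeriv q)
    {p p' : Plane} (hp : polyFun q p = 0) (h : ‖p'‖ = ‖p‖) : polyFun q p' = 0 := by
  obtain ⟨s, hs⟩ := hq
  obtain ⟨θ, hθ⟩ := exists_eq_polarPoint p
  obtain ⟨θ', hθ'⟩ := exists_eq_polarPoint p'
  rw [h] at hθ'
  set ρ := ‖p‖
  -- On the circle of radius `ρ`, `q` satisfies the linear equation `y' = s y`. A bound for `s`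
  -- gives the Lipschitz constant, and uniqueness propagates the zero.
  obtain ⟨K, hK⟩ := (isCompact_closedBall (0 : Plane) ρ).exists_bound_of_continuousOn
    (continuous_polyFun s).continuousOn
  have huniq := ODE_solution_unique_univ (K := K.toNNReal) (s := fun _ => Set.univ)
    (v := fun t x => polyFun s (polarPoint ρ t) * x)
    (f := fun t => polyFun q (polarPoint ρ t)) (g := fun _ => 0) (t₀ := θ)
    (fun t => by
      refine (LipschitzWith.of_dist_le_mul fun x y => ?_).lipschitzOnWith
      rw [Real.dist_eq, Real.dist_eq, ← mul_sub, abs_mul]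
      gcongr
      refine (hK (polarPoint ρ t) ?_).trans (Real.le_coe_toNNReal _)
      simp [norm_polarPoint (norm_nonneg p), ρ])
    (fun t => ⟨by
      have := hasDerivAt_polyFun_polarPoint q ρ t
      rwa [hs, polyFun_mul, mul_comm] at this, trivial⟩)
    (fun t => ⟨by simpa using hasDerivAt_const t (0 : ℝ), trivial⟩)
    (by rw [← hθ, hp])
  rw [hθ']
  exact congrFun huniq θ'

lemma analyticAt_polyFun_line (q : MvPolynomial (Fin 2) ℝ) (v : Plane) :
    AnalyticOnNhd ℝ (fun t : ℝ => polyFun q (t • v)) Set.univ := by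
  intro t _
  unfold polyFun
  simpa [MvPolynomial.aeval_eq_eval] using
    AnalyticAt.aeval_mvPolynomial (A := ℝ) (f := fun (t : ℝ) i => (t • v) i) (z := t) (fun i => by
      simp only [PiLp.smul_apply, smul_eq_mul]
      fun_prop) q

/-- Zeros accumulating at the origin would come with their whole circles. Every line through the
origin would then carry zeros accumulating at `0`, and `q` would vanish on it by analyticity. -/
lemma eventually_ne_zero_of_dvd_rotDeriv {q : MvPolynomial (Fin 2) ℝ} (hq0 : q ≠ 0)
    (hq : q ∣ rotDeriv q) : ∀ᶠ p in 𝓝[≠] (0 : Plane), polyFun q p ≠ 0 := by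
  by_contra hfreq
  rw [Filter.not_eventually] at hfreq
  simp only [not_not] at hfreq
  apply hq0
  refine MvPolynomial.funext fun x => ?_
  simp only [map_zero]
  have hline : ∀ v : Plane, ‖v‖ = 1 → ∀ t : ℝ, polyFun q (t • v) = 0 := by
    intro v hv
    have hfr : ∃ᶠ t in 𝓝[≠] (0 : ℝ), polyFun q (t • v) = (fun _ => 0) t := by
      have hn : Filter.Tendsto (fun p : Plane => ‖p‖) (𝓝[≠] 0) (𝓝[≠] (0 : ℝ)) :=
        tendsto_norm_nhdsNE_zero.mono_right (nhdsWithin_mono _ fun x hx => ne_of_gt hx)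
      refine hn.frequently (hfreq.mono fun p hp => ?_)
      exact polyFun_eq_zero_of_norm_eq hq hp (by simp [norm_smul, hv])
    have := (analyticAt_polyFun_line q v).eq_of_frequently_eq
      (fun t _ => analyticAt_const) hfr
    exact fun t => congrFun this t
  let w : Plane := WithLp.toLp 2 x
  change polyFun q w = 0
  obtain ⟨θ, hθ⟩ := exists_eq_polarPoint w
  have hw : w = ‖w‖ • polarPoint 1 θ := by
    conv_lhs => rw [hθ]
    ext i; fin_cases i <;> simp [polarPoint]
  rw [hw]
  exact hline _ (norm_polarPoint zero_le_one θ) _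

/-! ### Positivity of the radial derivative where the gradient is radial. -/

/-- If the rotational derivative of `q` does not vanish at a zero `p` of `q`, the zero set of `q`
near `p` is a curve transverse to the circles around the origin. If moreover `P` has radial gradient
pointing inwards along that curve, then moving along it towards the origin does not decrease `P`. -/
lemma exists_norm_lt_of_rotDeriv_ne_zero {P q : MvPolynomial (Fin 2) ℝ} {p : Plane}
    (hqP : q ∣ rotDeriv P) (hp0 : p ≠ 0) (hqp : polyFun q p = 0)
    (hrot : polyFun (rotDeriv q) p ≠ 0)
    (hE : ∀ᶠ x in 𝓝 p, polyFun q x = 0 → polyFun (eulerDeriv P) x ≤ 0) :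
    ∃ x, ‖x‖ < ‖p‖ ∧ polyFun q x = 0 ∧ polyFun (eulerDeriv P) x ≤ 0 ∧
      polyFun P p ≤ polyFun P x := by
  -- The Jacobian determinant of `G` is `2 * rotDeriv q`, so `G` is a local chart at `p`.
  let G : Plane → ℝ × ℝ := fun x => (‖x‖ ^ 2, polyFun q x)
  have hG : ContDiff ℝ 1 G :=
    (contDiff_norm_sq ℝ).prodMk ((contDiff_polyFun q).of_le (by exact_mod_cast le_top))
  have hGd : ∀ x, HasFDerivAt G ((2 • innerSL ℝ x).prod (innerSL ℝ (polyGrad q x))) x := fun x =>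
    (hasStrictFDerivAt_norm_sq x).hasFDerivAt.prodMk (hasFDerivAt_polyFun q x)
  have hinj : Function.Injective
      ((2 • innerSL ℝ p).prod (innerSL ℝ (polyGrad q p)) : Plane →ₗ[ℝ] ℝ × ℝ) := by
    rw [← LinearMap.ker_eq_bot, LinearMap.ker_eq_bot']
    intro v hv
    rw [polyFun_rotDeriv] at hrot
    simp [PiLp.inner_apply] at hv
    obtain ⟨h1, h2⟩ := hv
    ext i
    fin_cases i
    · refine (mul_eq_zero.1 (?_ : (p 0 * polyGrad q p 1 - p 1 * polyGrad q p 0) * v 0 = 0)).resolve_left hrot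
      linear_combination (polyGrad q p 1) * h1 - p 1 * h2
    · refine (mul_eq_zero.1 (?_ : (p 0 * polyGrad q p 1 - p 1 * polyGrad q p 0) * v 1 = 0)).resolve_left hrot
      linear_combination p 0 * h2 - (polyGrad q p 0) * h1
  let e : Plane ≃L[ℝ] ℝ × ℝ :=
    (LinearMap.linearEquivOfInjective _ hinj (by simp)).toContinuousLinearEquiv
  have he : HasFDerivAt G (e : Plane →L[ℝ] ℝ × ℝ) p := by
    convert! hGd p using 1
  have hstrict := hG.contDiffAt.hasStrictFDerivAt' he one_ne_zero
  -- The curve `q = 0` parametrized by squared distance to the origin; negative `t` leads inwards.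
  let γ : ℝ → Plane := fun t => hG.contDiffAt.localInverse he one_ne_zero (‖p‖ ^ 2 + t, 0)
  have hGp : G p = (‖p‖ ^ 2 + 0, 0) := by simp [G, hqp]
  have hγ0 : γ 0 = p := by
    have := hG.contDiffAt.localInverse_apply_image he one_ne_zero
    rwa [hGp] at this
  have hγc : ContDiffAt ℝ 1 γ 0 := by
    have h1 := hG.contDiffAt.to_localInverse he one_ne_zero
    rw [hGp] at h1
    exact ContDiffAt.comp (0 : ℝ) h1 (by fun_prop)
  have hline : Filter.Tendsto (fun t : ℝ => ((‖p‖ ^ 2 + t, 0) : ℝ × ℝ)) (𝓝 0) (𝓝 (G p)) := by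
    rw [hGp]
    exact Continuous.tendsto (by fun_prop) 0
  have hev1 : ∀ᶠ t in 𝓝 0, G (γ t) = (‖p‖ ^ 2 + t, 0) :=
    hline.eventually hstrict.eventually_right_inverse
  have hγt : Filter.Tendsto γ (𝓝 0) (𝓝 p) := by
    have := hγc.continuousAt.tendsto
    rwa [hγ0] at this
  have hev2 := hγc.eventually (by simp)
  have hev := (hev1.and hev2).and ((hγt.eventually hE).and (hγt.eventually_ne hp0))
  obtain ⟨d, hd, hball⟩ := Metric.eventually_nhds_iff.1 hev
  have hmem : ∀ t ∈ Set.Icc (-(d / 2)) 0, dist t 0 < d := fun t ht => by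
    rw [Real.dist_eq, abs_lt]; constructor <;> linarith [ht.1, ht.2]
  have hqγ : ∀ t, dist t 0 < d → polyFun q (γ t) = 0 := fun t ht =>
    congrArg Prod.snd (hball ht).1.1
  have hEγ : ∀ t, dist t 0 < d → polyFun (eulerDeriv P) (γ t) ≤ 0 := fun t ht =>
    (hball ht).2.1 (hqγ t ht)
  have hPd : ∀ t, dist t 0 < d → HasDerivAt (fun s => polyFun P (γ s))
      (inner ℝ (polyGrad P (γ t)) (deriv γ t)) t := fun t ht =>
    (hasFDerivAt_polyFun P (γ t)).comp_hasDerivAt t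
      ((hball ht).1.2.differentiableAt one_ne_zero).hasDerivAt
  have hneg : ∀ t, dist t 0 < d → inner ℝ (polyGrad P (γ t)) (deriv γ t) ≤ 0 := by
    intro t ht
    have hd' := ((hball ht).1.2.differentiableAt one_ne_zero).hasDerivAt
    have h1 : HasDerivAt (fun s => ‖γ s‖ ^ 2) (2 * inner ℝ (γ t) (deriv γ t)) t := by
      convert! (hasStrictFDerivAt_norm_sq (γ t)).hasFDerivAt.comp_hasDerivAt t hd' using 1
      simp
    have h2 : HasDerivAt (fun s => ‖γ s‖ ^ 2) 1 t := by
      refine HasDerivAt.congr_of_eventuallyEq ((hasDerivAt_id t).const_add (‖p‖ ^ 2)) ?_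
      filter_upwards [Metric.isOpen_ball.mem_nhds (Metric.mem_ball.2 ht)] with s hs
      exact congrArg Prod.fst (hball (Metric.mem_ball.1 hs)).1.1
    have h3 := h1.unique h2
    have h4 : polyFun (rotDeriv P) (γ t) = 0 := by
      obtain ⟨s, hs⟩ := hqP
      rw [hs, polyFun_mul, hqγ t ht, zero_mul]
    have h5 := hEγ t ht
    rw [polyFun_rotDeriv] at h4
    rw [polyFun_eulerDeriv] at h5
    have h6 : 0 < ‖γ t‖ ^ 2 := by
      have := (hball ht).2.2
      positivity
    rw [norm_sq_eq_coord] at h6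
    simp only [PiLp.inner_apply, Fin.sum_univ_two, RCLike.inner_apply, conj_trivial] at h3 h5 ⊢
    -- The gradient is parallel to `γ` and `⟨γ, γ'⟩ = 1/2`, so the derivative of `P` along `γ` has
    -- the sign of `eulerDeriv P`.
    have h7 : (γ t 0 ^ 2 + γ t 1 ^ 2) *
        (deriv γ t 0 * polyGrad P (γ t) 0 + deriv γ t 1 * polyGrad P (γ t) 1)
        = (γ t 0 * polyGrad P (γ t) 0 + γ t 1 * polyGrad P (γ t) 1) / 2 := by
      linear_combination (γ t 0 * polyGrad P (γ t) 0 + γ t 1 * polyGrad P (γ t) 1) / 2 * h3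
        + (γ t 0 * deriv γ t 1 - γ t 1 * deriv γ t 0) * h4
    nlinarith
  have hanti : AntitoneOn (fun s => polyFun P (γ s)) (Set.Icc (-(d / 2)) 0) := by
    refine antitoneOn_of_deriv_nonpos (convex_Icc _ _)
      (fun t ht => (hPd t (hmem t ht)).continuousAt.continuousWithinAt)
      (fun t ht => (hPd t (hmem t (interior_subset ht))).differentiableAt.differentiableWithinAt)
      (fun t ht => ?_)
    rw [(hPd t (hmem t (interior_subset ht))).deriv]
    exact hneg t (hmem t (interior_subset ht))
  have hl : -(d / 2) ∈ Set.Icc (-(d / 2)) 0 := ⟨le_rfl, by linarith⟩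
  refine ⟨γ (-(d / 2)), ?_, hqγ _ (hmem _ hl), hEγ _ (hmem _ hl), ?_⟩
  · have : ‖γ (-(d / 2))‖ ^ 2 = ‖p‖ ^ 2 + -(d / 2) := congrArg Prod.fst (hball (hmem _ hl)).1.1
    exact lt_of_pow_lt_pow_left₀ 2 (norm_nonneg _) (by linarith)
  · have := hanti hl ⟨by linarith, le_rfl⟩ (by linarith : -(d / 2) ≤ 0)
    simpa [hγ0] using this

/-- Descent by compactness: among the offending points where `P` is at least `P p₁`, take one
closest to the origin. It is not the origin because `P p₁ > 0`, and sliding along the curve produces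
a closer one. -/
lemma eventually_eulerDeriv_pos_of_irreducible {P q : MvPolynomial (Fin 2) ℝ}
    (hzero : polyFun P 0 = 0) (hmin : IsStrictLocalMin (polyFun P) 0)
    (hq : Irreducible q) (hqP : q ∣ rotDeriv P) (hrot : ¬ q ∣ rotDeriv q) :
    ∀ᶠ p in 𝓝[≠] (0 : Plane), polyFun q p = 0 → 0 < polyFun (eulerDeriv P) p := by
  -- The sign condition is open along the curve: either `q` divides `eulerDeriv P`, which then
  -- vanishes on it, or near the origin `eulerDeriv P` has no zeros on it except possibly at the
  -- origin.
  have hE : ∀ᶠ p in 𝓝[≠] (0 : Plane), polyFun q p = 0 → polyFun (eulerDeriv P) p ≤ 0 →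
      ∀ᶠ x in 𝓝 p, polyFun q x = 0 → polyFun (eulerDeriv P) x ≤ 0 := by
    by_cases h : q ∣ eulerDeriv P
    · refine Filter.Eventually.of_forall fun p _ _ => Filter.Eventually.of_forall fun x hx => ?_
      obtain ⟨s, hs⟩ := h
      rw [hs, polyFun_mul, hx, zero_mul]
    · filter_upwards [eventually_not_common_zero hq h] with p hp hqp hEp
      have hlt : polyFun (eulerDeriv P) p < 0 := lt_of_le_of_ne hEp fun h0 => hp ⟨hqp, h0⟩
      filter_upwards [(continuous_polyFun (eulerDeriv P)).continuousAt.eventually_lt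
        continuousAt_const hlt] with x hx _
      exact hx.le
  have hall := hE.and ((eventually_not_common_zero hq hrot).and hmin)
  rw [eventually_nhdsWithin_iff, Metric.eventually_nhds_iff] at hall
  obtain ⟨δ, hδ, hall⟩ := hall
  rw [eventually_nhdsWithin_iff, Metric.eventually_nhds_iff]
  refine ⟨δ, hδ, fun p₁ hp₁ hp₁0 hqp₁ => ?_⟩
  by_contra! hEp₁
  have hf₁ : 0 < polyFun P p₁ := by simpa [hzero] using (hall hp₁ hp₁0).2.2
  let A : Set Plane := Metric.closedBall 0 ‖p₁‖ ∩ {p | polyFun q p = 0 ∧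
    polyFun (eulerDeriv P) p ≤ 0 ∧ polyFun P p₁ ≤ polyFun P p}
  have hA : IsCompact A := by
    refine (isCompact_closedBall _ _).inter_right ?_
    exact (isClosed_eq (continuous_polyFun q) continuous_const).inter
      ((isClosed_le (continuous_polyFun _) continuous_const).inter
        (isClosed_le continuous_const (continuous_polyFun _)))
  obtain ⟨p, ⟨hpball, hqp, hEp, hfp⟩, hpmin⟩ := hA.exists_isMinOn
    ⟨p₁, by simp, hqp₁, hEp₁, le_rfl⟩ continuous_norm.continuousOn
  have hp0 : p ≠ 0 := by
    rintro rfl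
    rw [hzero] at hfp
    linarith
  have hpd : dist p 0 < δ := lt_of_le_of_lt hpball (by simpa using hp₁)
  obtain ⟨h1, h2, -⟩ := hall hpd hp0
  obtain ⟨x, hx, hqx, hEx, hfx⟩ := exists_norm_lt_of_rotDeriv_ne_zero hqP hp0 hqp
    (fun h => h2 ⟨hqp, h⟩) (h1 hqp hEp)
  have hxA : x ∈ A :=
    ⟨by simpa using hx.le.trans (by simpa using hpball), hqx, hEx, hfp.trans hfx⟩
  exact absurd (hpmin hxA) (by simpa using hx)

lemma eventually_eulerDeriv_pos_of_dvd_rotDeriv {P : MvPolynomial (Fin 2) ℝ}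
    (hzero : polyFun P 0 = 0) (hmin : IsStrictLocalMin (polyFun P) 0) (d : MvPolynomial (Fin 2) ℝ)
    (hd0 : d ≠ 0) (hd : d ∣ rotDeriv P) :
    ∀ᶠ p in 𝓝[≠] (0 : Plane), polyFun d p = 0 → 0 < polyFun (eulerDeriv P) p := by
  induction d using UniqueFactorizationMonoid.induction_on_prime with
  | h₁ => exact absurd rfl hd0
  | h₂ x hx =>
    refine Filter.Eventually.of_forall fun p hp => ?_
    exact absurd hp (hx.map (MvPolynomial.eval fun i => p i)).ne_zero
  | h₃ a q ha hq ih =>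
    have h1 := ih ha ((dvd_mul_left a q).trans hd)
    have h2 : ∀ᶠ p in 𝓝[≠] (0 : Plane), polyFun q p = 0 → 0 < polyFun (eulerDeriv P) p := by
      by_cases hrot : q ∣ rotDeriv q
      · filter_upwards [eventually_ne_zero_of_dvd_rotDeriv hq.ne_zero hrot] with p hp h0
        exact absurd h0 hp
      · exact eventually_eulerDeriv_pos_of_irreducible hzero hmin hq.irreducible
          ((dvd_mul_right q a).trans hd) hrot
    filter_upwards [h1, h2] with p h1 h2 hp
    rw [polyFun_mul, mul_eq_zero] at hp
    exact hp.elim h2 h1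

/-- Infinitesimal rotations and dilations commute, as do the mixed partial derivatives. -/
lemma rotDeriv_eulerDeriv (P : MvPolynomial (Fin 2) ℝ) :
    rotDeriv (eulerDeriv P) = eulerDeriv (rotDeriv P) := by
  have hcomm : MvPolynomial.pderiv 0 (MvPolynomial.pderiv 1 P)
      = MvPolynomial.pderiv 1 (MvPolynomial.pderiv 0 P) := by
    have h : ⁅MvPolynomial.pderiv (R := ℝ) (0 : Fin 2),
        MvPolynomial.pderiv (R := ℝ) (1 : Fin 2)⁆ = 0 :=
      MvPolynomial.derivation_ext fun i => by
        fin_cases i <;> simp [Derivation.commutator_apply, MvPolynomial.pderiv_X]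
    have h2 := DFunLike.congr_fun h P
    rwa [Derivation.commutator_apply, Derivation.zero_apply, sub_eq_zero] at h2
  simp only [rotDeriv, eulerDeriv, map_add, map_sub, Derivation.leibniz, smul_eq_mul,
    MvPolynomial.pderiv_X, hcomm]
  simp
  ring

lemma eventually_eulerDeriv_pos {P : MvPolynomial (Fin 2) ℝ}
    (hzero : polyFun P 0 = 0) (hmin : IsStrictLocalMin (polyFun P) 0) :
    ∀ᶠ p in 𝓝[≠] (0 : Plane), polyFun (rotDeriv P) p = 0 → 0 < polyFun (eulerDeriv P) p := by
  -- A zero `rotDeriv P` has no prime factorization, but then every `q` divides it. The choice `q =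
  -- X 1` settles the horizontal axis, and `eulerDeriv P` is constant on circles.
  by_cases h0 : rotDeriv P = 0
  · have hX : rotDeriv (MvPolynomial.X 1) = MvPolynomial.X 0 := by
      simp [rotDeriv, MvPolynomial.pderiv_X]
    have h1 := eventually_eulerDeriv_pos_of_irreducible (q := MvPolynomial.X 1) hzero hmin
      MvPolynomial.X_prime.irreducible (by simp [h0]) (by
        rw [hX, MvPolynomial.X_dvd_X]; simp)
    rw [eventually_nhdsWithin_iff, Metric.eventually_nhds_iff] at h1 ⊢
    obtain ⟨δ, hδ, h1⟩ := h1
    refine ⟨δ, hδ, fun p hp hp0 _ => ?_⟩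
    obtain ⟨θ, hθ⟩ := exists_eq_polarPoint p
    have hconst : ∀ t, polyFun (eulerDeriv P) (polarPoint ‖p‖ t)
        = polyFun (eulerDeriv P) (polarPoint ‖p‖ 0) := fun t => by
      refine is_const_of_deriv_eq_zero
        (fun s => (hasDerivAt_polyFun_polarPoint (eulerDeriv P) ‖p‖ s).differentiableAt)
        (fun s => ?_) t 0
      rw [(hasDerivAt_polyFun_polarPoint (eulerDeriv P) ‖p‖ s).deriv, rotDeriv_eulerDeriv, h0]
      simp [eulerDeriv, polyFun]
    rw [hθ, hconst]
    have hn := norm_polarPoint (norm_nonneg p) 0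
    refine h1 (by simpa [hn] using hp) ?_ (by simp [polyFun, polarPoint])
    rw [Set.mem_compl_singleton_iff, ← norm_pos_iff, hn]
    exact norm_pos_iff.2 hp0
  · exact eventually_eulerDeriv_pos_of_dvd_rotDeriv hzero hmin _ h0 dvd_rfl

/-- Near a strict local minimum at the origin the gradient of a polynomial never vanishes and never
points towards the origin. -/
lemma eventually_polyGrad_combination_ne_zero {P : MvPolynomial (Fin 2) ℝ}
    (hzero : polyFun P 0 = 0) (hmin : IsStrictLocalMin (polyFun P) 0) :
    ∀ᶠ p in 𝓝[≠] (0 : Plane), ∀ a b : ℝ, 0 ≤ a → 0 ≤ b → 0 < a + b →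
      a • polyGrad P p + b • p ≠ 0 := by
  filter_upwards [eventually_eulerDeriv_pos hzero hmin, self_mem_nhdsWithin]
    with p hp hp0 a b ha hb hab h
  rcases ha.eq_or_lt with rfl | ha
  · rw [zero_smul, zero_add, smul_eq_zero] at h
    exact h.elim (fun hb0 => by simp [hb0] at hab) hp0
  -- An inward radial gradient makes `rotDeriv P` zero and `eulerDeriv P` nonpositive, against `hp`.
  have hg : polyGrad P p = -(b / a) • p := by
    have h1 : a • polyGrad P p = -(b • p) := eq_neg_of_add_eq_zero_left h
    have := congrArg (fun v => a⁻¹ • v) h1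
    simp only [inv_smul_smul₀ ha.ne', smul_neg, smul_smul] at this
    rw [this, neg_smul, div_eq_inv_mul]
  have h2 := hp (by rw [polyFun_rotDeriv, hg]; simp; ring)
  rw [polyFun_eulerDeriv, hg, inner_smul_left, real_inner_self_eq_norm_sq] at h2
  have h3 : 0 ≤ b / a * ‖p‖ ^ 2 := by positivity
  simp at h2
  linarith

/-! ### Smoothness of superposition operators. -/

section Nemytskii

variable {K : Type} [TopologicalSpace K] [CompactSpace K]
  {E F : Type} [NormedAddCommGroup E] [NormedAddCommGroup F]

/-- The superposition operator `u ↦ W ∘ u` on spaces of continuous functions. -/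
def superposition {W : E → F} (hW : Continuous W) (u : C(K, E)) : C(K, F) :=
  ⟨fun t => W (u t), by fun_prop⟩

lemma lipschitzWith_superposition {W : E → F} (hW : Continuous W) {c : NNReal}
    (hL : LipschitzWith c W) : LipschitzWith c (superposition (K := K) hW) := by
  refine LipschitzWith.of_dist_le_mul fun u v => ?_
  refine (ContinuousMap.dist_le (by positivity)).2 fun t => ?_
  exact (hL.dist_le_mul _ _).trans (by gcongr; exact ContinuousMap.dist_apply_le_dist t)

variable [NormedSpace ℝ E] [NormedSpace ℝ F]

/-- Pointwise application of a continuous family of operators, as a continuous linear map in the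
family. -/
noncomputable def pointwiseApply : C(K, E →L[ℝ] F) →L[ℝ] C(K, E) →L[ℝ] C(K, F) :=
  LinearMap.mkContinuous₂
    (LinearMap.mk₂ ℝ (fun (A : C(K, E →L[ℝ] F)) (u : C(K, E)) =>
        (⟨fun t => A t (u t), by fun_prop⟩ : C(K, F)))
      (fun A B u => by ext t; simp) (fun c A u => by ext t; simp)
      (fun A u v => by ext t; simp) (fun c A u => by ext t; simp))
    1 (fun A u => by
      rw [one_mul]
      refine (ContinuousMap.norm_le _ (by positivity)).2 fun t => ?_
      exact ((A t).le_opNorm (u t)).trans (mul_le_mul (A.norm_coe_le_norm t) (u.norm_coe_le_norm t)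
        (norm_nonneg _) (by positivity)))

lemma hasFDerivAt_superposition {W : E → F} (hW : ContDiff ℝ ∞ W) (hc : HasCompactSupport W)
    (u : C(K, E)) :
    HasFDerivAt (superposition (K := K) hW.continuous)
      (pointwiseApply (superposition (hW.continuous_fderiv (by simp)) u)) u := by
  obtain ⟨C, hC⟩ := ((hW.fderiv_right (m := ∞) (by simp)).lipschitzWith_of_hasCompactSupport
    (hc.fderiv (𝕜 := ℝ)) (by simp) : ∃ C, LipschitzWith C (fderiv ℝ W))
  refine HasFDerivAt.of_isLittleO ?_
  -- The Lipschitz derivative of `W` makes the Taylor remainder quadratic, uniformly in `t`.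
  have hb : ∀ v : C(K, E), ‖superposition (K := K) hW.continuous v -
      superposition (K := K) hW.continuous u -
      pointwiseApply (superposition (hW.continuous_fderiv (by simp)) u) (v - u)‖
      ≤ C * ‖v - u‖ * ‖v - u‖ := by
    intro v
    refine (ContinuousMap.norm_le _ (by positivity)).2 fun t => ?_
    change ‖W (v t) - W (u t) - fderiv ℝ W (u t) (v t - u t)‖ ≤ _
    have hvu : ‖v t - u t‖ ≤ ‖v - u‖ := (v - u).norm_coe_le_norm t
    have := (convex_closedBall (u t) ‖v t - u t‖).norm_image_sub_le_of_norm_fderiv_le'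
      (f := W) (𝕜 := ℝ) (φ := fderiv ℝ W (u t)) (C := C * ‖v - u‖) (x := u t) (y := v t)
      (fun x _ => hW.differentiable (by simp) x)
      (fun x hx => by
        refine (hC.norm_sub_le x (u t)).trans ?_
        gcongr
        exact (mem_closedBall_iff_norm.1 hx).trans hvu)
      (by simp) (by simp [dist_eq_norm])
    exact this.trans (by gcongr)
  refine (Asymptotics.isBigO_of_le' (c := C) (g := fun v => ‖v - u‖ ^ 2) _ fun v => ?_).trans_isLittleO
    ?_
  · simpa [pow_two, mul_assoc] using hb v
  · have := (Asymptotics.isLittleO_pow_id (𝕜 := ℝ) one_lt_two).comp_tendsto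
      (show Filter.Tendsto (fun v : C(K, E) => ‖v - u‖) (𝓝 u) (𝓝 0) by
        have h : Continuous fun v : C(K, E) => ‖v - u‖ := by fun_prop
        simpa using h.tendsto u)
    exact this.of_norm_right

/-- The derivative is again a superposition operator, by `fderiv ℝ W`, followed by a continuous
linear map. The induction therefore has to let the target space vary. -/
lemma contDiff_superposition {W : E → F} (hW : ContDiff ℝ ∞ W) (hc : HasCompactSupport W) :
    ContDiff ℝ ∞ (superposition (K := K) hW.continuous) := by
  rw [contDiff_infty]
  intro n
  induction n generalizing F with
  | zero =>
    exact contDiff_zero.2 (continuous_iff_continuousAt.2 fun u =>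
      (hasFDerivAt_superposition hW hc u).continuousAt)
  | succ n ih =>
    have h : ((n + 1 : ℕ) : WithTop ℕ∞) = (n : WithTop ℕ∞) + 1 := by norm_cast
    rw [h, contDiff_succ_iff_hasFDerivAt]
    refine ⟨_, ?_, hasFDerivAt_superposition hW hc⟩
    exact pointwiseApply.contDiff.comp (ih (hW.fderiv_right (m := ∞) (by simp)) (hc.fderiv (𝕜 := ℝ)))

end Nemytskii

/-! ### Smooth time-one maps from the Volterra integral equation. -/

section TimeOneMap

variable {E : Type} [NormedAddCommGroup E]

/-- Extension of a continuous function on `[0, 1]` to the line by constants. -/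
noncomputable def extendIcc (u : C(Set.Icc (0 : ℝ) 1, E)) : ℝ → E :=
  Set.IccExtend zero_le_one u

lemma continuous_extendIcc (u : C(Set.Icc (0 : ℝ) 1, E)) : Continuous (extendIcc u) :=
  u.continuous.Icc_extend'

variable [NormedSpace ℝ E]

lemma norm_integral_extendIcc_le (u : C(Set.Icc (0 : ℝ) 1, E)) (t : Set.Icc (0 : ℝ) 1) :
    ‖∫ s in (0 : ℝ)..t, extendIcc u s‖ ≤ ‖u‖ := by
  refine (intervalIntegral.norm_integral_le_of_norm_le_const (C := ‖u‖)
    fun s _ => u.norm_coe_le_norm _).trans ?_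
  have h1 : |(t : ℝ) - 0| ≤ 1 := by
    rw [sub_zero, abs_of_nonneg t.2.1]; exact t.2.2
  exact mul_le_of_le_one_right (norm_nonneg u) h1

/-- The Volterra operator `u ↦ ∫₀ᵗ u`. -/
noncomputable def volterra : C(Set.Icc (0 : ℝ) 1, E) →L[ℝ] C(Set.Icc (0 : ℝ) 1, E) :=
  LinearMap.mkContinuous
    { toFun := fun u => ⟨fun t => ∫ s in (0 : ℝ)..t, extendIcc u s,
        (intervalIntegral.continuous_primitive
          (fun a b => (continuous_extendIcc u).intervalIntegrable a b) 0).comp continuous_subtype_val⟩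
      map_add' := fun u v => by
        ext t
        exact intervalIntegral.integral_add ((continuous_extendIcc u).intervalIntegrable _ _)
          ((continuous_extendIcc v).intervalIntegrable _ _)
      map_smul' := fun c u => by
        ext t
        exact intervalIntegral.integral_smul c (extendIcc u) }
    1 (fun u => by
      rw [one_mul]
      exact (ContinuousMap.norm_le _ (norm_nonneg u)).2 (norm_integral_extendIcc_le u))

lemma norm_volterra_apply_le (u : C(Set.Icc (0 : ℝ) 1, E)) : ‖volterra u‖ ≤ ‖u‖ :=
  (ContinuousMap.norm_le _ (norm_nonneg u)).2 (norm_integral_extendIcc_le u)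

/-- The map `u ↦ u - ∫ W ∘ u` whose preimages of constants are the integral curves of `W`. -/
noncomputable def volterraDefect {W : E → E} (hW : Continuous W) (u : C(Set.Icc (0 : ℝ) 1, E)) :
    C(Set.Icc (0 : ℝ) 1, E) := u - volterra (superposition hW u)

lemma lipschitzWith_volterra_superposition {W : E → E} (hW : Continuous W) {c : NNReal}
    (hL : LipschitzWith c W) : LipschitzWith c fun u => volterra (superposition hW u) := by
  refine LipschitzWith.of_dist_le_mul fun u v => ?_
  rw [dist_eq_norm, ← map_sub]
  refine (norm_volterra_apply_le _).trans ?_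
  rw [← dist_eq_norm]
  exact (lipschitzWith_superposition hW hL).dist_le_mul u v

variable [CompleteSpace E]

/-- The defect is the identity minus a `c`-Lipschitz map with `c < 1`, hence a homeomorphism. Its
derivatives are invertible by the Neumann series, so the inverse is smooth. -/
lemma exists_contDiff_inverse_volterraDefect {W : E → E} (hW : ContDiff ℝ ∞ W)
    (hc : HasCompactSupport W) {c : NNReal} (hL : LipschitzWith c W) (hc1 : c < 1) :
    ∃ S : C(Set.Icc (0 : ℝ) 1, E) → C(Set.Icc (0 : ℝ) 1, E), ContDiff ℝ ∞ S ∧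
      ∀ u, volterraDefect hW.continuous (S u) = u := by
  let X := C(Set.Icc (0 : ℝ) 1, E)
  have hL' := lipschitzWith_volterra_superposition hW.continuous hL
  have happ : ApproximatesLinearOn (volterraDefect hW.continuous)
      ((ContinuousLinearEquiv.refl ℝ X : X ≃L[ℝ] X) : X →L[ℝ] X) Set.univ c := by
    intro u _ v _
    have h := hL'.norm_sub_le v u
    change ‖(u - volterra (superposition hW.continuous u)) -
      (v - volterra (superposition hW.continuous v)) - (u - v)‖ ≤ _
    rw [norm_sub_rev u v]
    have e : u - volterra (superposition hW.continuous u) -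
        (v - volterra (superposition hW.continuous v)) - (u - v) =
        volterra (superposition hW.continuous v) - volterra (superposition hW.continuous u) := by
      abel
    rw [e]
    exact h
  have hcs : Subsingleton X ∨
      c < ‖((ContinuousLinearEquiv.refl ℝ X).symm : X →L[ℝ] X)‖₊⁻¹ := by
    rcases subsingleton_or_nontrivial X with h | h
    · exact Or.inl h
    · right
      simpa using hc1
  let Θ := happ.toHomeomorph _ hcs
  have hΘ : ⇑Θ = volterraDefect hW.continuous := rfl
  have hs : ContDiff ℝ ∞ fun u : X => volterra (superposition hW.continuous u) :=
    volterra.contDiff.comp (contDiff_superposition hW hc)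
  have hΘc : ContDiff ℝ ∞ Θ := contDiff_id.sub hs
  have hder : ∀ u : X, ∃ e : X ≃L[ℝ] X, HasFDerivAt Θ (e : X →L[ℝ] X) u := by
    intro u
    let A : X →L[ℝ] X := fderiv ℝ (fun u : X => volterra (superposition hW.continuous u)) u
    have hA : ‖A‖ < 1 := lt_of_le_of_lt (norm_fderiv_le_of_lipschitz ℝ hL') (by exact_mod_cast hc1)
    refine ⟨ContinuousLinearEquiv.unitsEquiv ℝ X (Units.oneSub A hA), ?_⟩
    exact (hasFDerivAt_id u).sub ((hs.differentiable (by simp) u).hasFDerivAt)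
  choose e he using hder
  refine ⟨Θ.symm, Θ.contDiff_symm he hΘc, fun u => ?_⟩
  rw [← hΘ]
  exact Θ.apply_symm_apply u

/-- Applying the inverse of the defect to the constant `x` solves `u = x + ∫ W ∘ u`. Evaluation at
time `1` is linear, so smooth dependence on `x` comes for free. -/
lemma exists_integralCurve_family {W : E → E} (hW : ContDiff ℝ ∞ W)
    (hc : HasCompactSupport W) {c : NNReal} (hL : LipschitzWith c W) (hc1 : c < 1) :
    ∃ φ : E → E, ContDiff ℝ ∞ φ ∧ ∀ x, ∃ u : ℝ → E, u 0 = x ∧ u 1 = φ x ∧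
      ∀ t ∈ Set.Icc (0 : ℝ) 1, HasDerivAt u (W (u t)) t := by
  obtain ⟨S, hS, hSu⟩ := exists_contDiff_inverse_volterraDefect hW hc hL hc1
  let cst : E →L[ℝ] C(Set.Icc (0 : ℝ) 1, E) := ContinuousLinearMap.const ℝ _
  let one : Set.Icc (0 : ℝ) 1 := ⟨1, by simp⟩
  let ev : C(Set.Icc (0 : ℝ) 1, E) →L[ℝ] E := ContinuousMap.evalCLM ℝ one
  refine ⟨fun x => ev (S (cst x)), ev.contDiff.comp (hS.comp cst.contDiff), fun x => ?_⟩
  have hfix : ∀ t : Set.Icc (0 : ℝ) 1, S (cst x) t =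
      x + ∫ s in (0 : ℝ)..t, extendIcc (superposition hW.continuous (S (cst x))) s := fun t => by
    have h := DFunLike.congr_fun (hSu (cst x)) t
    exact sub_eq_iff_eq_add.1 h
  have hcont := continuous_extendIcc (superposition hW.continuous (S (cst x)))
  refine ⟨fun t => x + ∫ s in (0 : ℝ)..t, extendIcc (superposition hW.continuous (S (cst x))) s,
    by simp, (hfix one).symm, fun t ht => ?_⟩
  have h1 := (hcont.integral_hasStrictDerivAt 0 t).hasDerivAt.const_add x
  have h2 : extendIcc (superposition hW.continuous (S (cst x))) t = W (S (cst x) ⟨t, ht⟩) := by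
    rw [extendIcc, Set.IccExtend_of_mem zero_le_one _ ht]; rfl
  rw [h2, hfix ⟨t, ht⟩] at h1
  exact h1

/-- The time one map of a compactly supported smooth vector field with small Lipschitz constant is
a smooth diffeomorphism. -/
lemma exists_flow_diffeo {W : E → E} (hW : ContDiff ℝ ∞ W)
    (hc : HasCompactSupport W) {c : NNReal} (hL : LipschitzWith c W) (hc1 : c < 1) :
    ∃ φ ψ : E → E, ContDiff ℝ ∞ φ ∧ ContDiff ℝ ∞ ψ ∧ Function.LeftInverse ψ φ ∧
      Function.RightInverse ψ φ ∧
      (∀ x, ∃ u : ℝ → E, u 0 = x ∧ u 1 = φ x ∧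
        ∀ t ∈ Set.Icc (0 : ℝ) 1, HasDerivAt u (W (u t)) t) ∧
      (∀ x, ∃ u : ℝ → E, u 0 = x ∧ u 1 = ψ x ∧
        ∀ t ∈ Set.Icc (0 : ℝ) 1, HasDerivAt u (-W (u t)) t) := by
  have key : ∀ (V : E → E), LipschitzWith c V → ∀ φ ψ : E → E,
      (∀ x, ∃ u : ℝ → E, u 0 = x ∧ u 1 = φ x ∧
        ∀ t ∈ Set.Icc (0 : ℝ) 1, HasDerivAt u (V (u t)) t) →
      (∀ x, ∃ u : ℝ → E, u 0 = x ∧ u 1 = ψ x ∧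
        ∀ t ∈ Set.Icc (0 : ℝ) 1, HasDerivAt u (-V (u t)) t) → ∀ x, ψ (φ x) = x := by
    intro V hV φ ψ hφ hψ x
    obtain ⟨u, hu0, hu1, hu⟩ := hφ x
    obtain ⟨v, hv0, hv1, hv⟩ := hψ (φ x)
    -- The reversed curve solves the equation of `-V` with the initial value of `v`, so uniqueness
    -- identifies the two.
    have hw : ∀ t ∈ Set.Icc (0 : ℝ) 1,
        HasDerivAt (fun s => u (1 - s)) (-V (u (1 - t))) t := fun t ht => by
      have h1 := hu (1 - t) ⟨by linarith [ht.2], by linarith [ht.1]⟩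
      have h2 : HasDerivAt (fun s : ℝ => 1 - s) (-1) t := by
        simpa using (hasDerivAt_id t).const_sub 1
      simpa [Function.comp_def] using h1.scomp t h2
    have huniq := ODE_solution_unique_of_mem_Icc_right (a := 0) (b := 1) (K := c)
      (s := fun _ => Set.univ) (v := fun _ y => -V y) (f := v) (g := fun s => u (1 - s))
      (fun t _ => hV.neg.lipschitzOnWith)
      (fun t ht => (hv t ht).continuousAt.continuousWithinAt)
      (fun t ht => (hv t ⟨ht.1, ht.2.le⟩).hasDerivWithinAt) (fun _ _ => trivial)
      (fun t ht => (hw t ht).continuousAt.continuousWithinAt)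
      (fun t ht => (hw t ⟨ht.1, ht.2.le⟩).hasDerivWithinAt) (fun _ _ => trivial)
      (by simp [hv0, hu1])
    have := huniq (show (1 : ℝ) ∈ Set.Icc (0 : ℝ) 1 by simp)
    simpa [hv1, hu0] using this
  obtain ⟨φ, hφ, hφu⟩ := exists_integralCurve_family hW hc hL hc1
  obtain ⟨ψ, hψ, hψu⟩ := exists_integralCurve_family hW.neg hc.neg hL.neg hc1
  refine ⟨φ, ψ, hφ, hψ, key W hL φ ψ hφu hψu, key (-W) hL.neg ψ φ hψu ?_, hφu, hψu⟩
  simpa using hφu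

end TimeOneMap

/-! ### Transfer of the topology of the unit disk through a diffeomorphism of the plane. -/

section Transfer

lemma continuous_polarPoint_uncurry : Continuous fun z : ℝ × ℝ => polarPoint z.1 z.2 := by
  refine (PiLp.continuous_toLp 2 (fun _ : Fin 2 => ℝ)).comp (continuous_pi fun i => ?_)
  fin_cases i
  · simpa using! (by fun_prop : Continuous fun z : ℝ × ℝ => z.1 * Real.cos z.2)
  · simpa using! (by fun_prop : Continuous fun z : ℝ × ℝ => z.1 * Real.sin z.2)

lemma continuous_polarPoint (ρ : ℝ) : Continuous (polarPoint ρ) :=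
  continuous_polarPoint_uncurry.comp (by fun_prop : Continuous fun t : ℝ => (ρ, t))

lemma isPreconnected_norm_gt_one : IsPreconnected {y : Plane | 1 < ‖y‖} := by
  have h : {y : Plane | 1 < ‖y‖} =
      (fun z : ℝ × ℝ => polarPoint z.1 z.2) '' (Set.Ioi 1 ×ˢ Set.univ) := by
    ext y
    constructor
    · intro hy
      obtain ⟨θ, hθ⟩ := exists_eq_polarPoint y
      exact ⟨(‖y‖, θ), ⟨hy, trivial⟩, hθ.symm⟩
    · rintro ⟨⟨ρ, θ⟩, ⟨hρ, -⟩, rfl⟩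
      have hρ' : (1 : ℝ) < ρ := hρ
      simpa [norm_polarPoint (by linarith : (0 : ℝ) ≤ ρ)] using hρ'
  rw [h]
  exact (isPreconnected_Ioi.prod isPreconnected_univ).image _
    continuous_polarPoint_uncurry.continuousOn

lemma polarPoint_injOn : Set.InjOn (polarPoint 1) (Set.Ico 0 (2 * Real.pi)) := by
  intro s hs t ht h
  have h0 : Real.cos s = Real.cos t := by
    simpa [polarPoint] using congrArg (fun p : Plane => p 0) h
  have h1 : Real.sin s = Real.sin t := by
    simpa [polarPoint] using congrArg (fun p : Plane => p 1) h
  have h2 : (s : Real.Angle) = t := Real.Angle.cos_sin_inj h0 h1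
  have h3 := (Real.Angle.angle_eq_iff_two_pi_dvd_sub).1 h2
  obtain ⟨k, hk⟩ := h3
  have hpi := Real.pi_pos
  have hk1 : (k : ℝ) < 1 := by
    by_contra! hc
    nlinarith [hs.1, hs.2, ht.1, ht.2]
  have hk2 : (-1 : ℝ) < k := by
    by_contra! hc
    nlinarith [hs.1, hs.2, ht.1, ht.2]
  have hk0 : k = 0 := by
    have a1 : k < 1 := by exact_mod_cast hk1
    have a2 : -1 < k := by exact_mod_cast hk2
    omega
  rw [hk0] at hk
  simp at hk
  linarith

lemma image_polarPoint_Icc : polarPoint 1 '' Set.Icc 0 (2 * Real.pi) = Metric.sphere 0 1 := by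
  ext y
  constructor
  · rintro ⟨t, -, rfl⟩
    simp [norm_polarPoint]
  · intro hy
    have hy1 : ‖y‖ = 1 := by simpa using hy
    obtain ⟨θ, hθ⟩ := exists_eq_polarPoint y
    rw [hy1] at hθ
    refine ⟨toIcoMod Real.two_pi_pos 0 θ, ?_, ?_⟩
    · have := toIcoMod_mem_Ico Real.two_pi_pos 0 θ
      rw [zero_add] at this
      exact Set.Ico_subset_Icc_self this
    · rw [hθ]
      have h : toIcoMod Real.two_pi_pos 0 θ = θ - toIcoDiv Real.two_pi_pos 0 θ * (2 * Real.pi) := by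
        have := self_sub_toIcoDiv_zsmul Real.two_pi_pos 0 θ
        rw [← this, zsmul_eq_mul]
      simp only [polarPoint]
      rw [h, Real.cos_sub_int_mul_two_pi, Real.sin_sub_int_mul_two_pi]

variable {φ ψ : Plane → Plane}

lemma diffeomorphic_preimage (hφ : ContDiff ℝ ∞ φ) (hψ : ContDiff ℝ ∞ ψ)
    (h1 : Function.LeftInverse ψ φ) (h2 : Function.RightInverse ψ φ) (Y : Set Plane) :
    Diffeomorphic (φ ⁻¹' Y) Y := by
  refine ⟨φ, ψ, fun x hx => hx, fun y hy => ?_, ⟨fun x _ => h1 x, fun y _ => h2 y⟩,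
    fun x _ => ⟨Set.univ, φ, isOpen_univ, trivial, hφ.contDiffOn, fun _ _ => rfl⟩,
    fun x _ => ⟨Set.univ, ψ, isOpen_univ, trivial, hψ.contDiffOn, fun _ _ => rfl⟩⟩
  rw [Set.mem_preimage, h2 y]
  exact hy

lemma isJordanCurve_preimage_sphere (hψ : Continuous ψ)
    (h1 : Function.LeftInverse ψ φ) (h2 : Function.RightInverse ψ φ) :
    IsJordanCurve (φ ⁻¹' Metric.sphere 0 1) := by
  refine ⟨0, 2 * Real.pi, fun t => ψ (polarPoint 1 t), Real.two_pi_pos,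
    (hψ.comp (continuous_polarPoint 1)).continuousOn, by simp [polarPoint],
    fun s hs t ht h => polarPoint_injOn hs ht (h2.injective h), ?_⟩
  rw [← image_polarPoint_Icc, ← Set.image_eq_preimage_of_inverse h2 h1, Set.image_image]

lemma connectedComponentIn_eq_of_separated {X : Type*} [TopologicalSpace X] {A B : Set X} {x : X}
    (hA : IsOpen A) (hB : IsOpen B) (hAB : Disjoint A B) (hc : IsPreconnected A) (hx : x ∈ A) :
    connectedComponentIn (A ∪ B) x = A := by
  refine Set.Subset.antisymm ?_ (hc.subset_connectedComponentIn hx Set.subset_union_left)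
  exact isPreconnected_connectedComponentIn.subset_left_of_subset_union hA hB hAB
    (connectedComponentIn_subset _ _) ⟨x, mem_connectedComponentIn (Or.inl hx), hx⟩

lemma boundedComplementComponents_preimage_sphere (hφ : Continuous φ) (hψ : Continuous ψ)
    (h1 : Function.LeftInverse ψ φ) (h2 : Function.RightInverse ψ φ) :
    boundedComplementComponents (φ ⁻¹' Metric.sphere 0 1) = {φ ⁻¹' Metric.ball 0 1} := by
  set A : Set Plane := φ ⁻¹' Metric.ball 0 1
  set B : Set Plane := φ ⁻¹' {y | 1 < ‖y‖}
  have himg : ∀ S : Set Plane, φ ⁻¹' S = ψ '' S := fun S =>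
    congrFun (Set.image_eq_preimage_of_inverse h2 h1).symm S
  have hcompl : (φ ⁻¹' Metric.sphere 0 1)ᶜ = A ∪ B := by
    ext x
    simp [A, B, lt_or_lt_iff_ne]
  have hA : IsOpen A := Metric.isOpen_ball.preimage hφ
  have hB : IsOpen B := (isOpen_lt continuous_const continuous_norm).preimage hφ
  have hAB : Disjoint A B := by
    rw [Set.disjoint_left]
    intro x hx hx'
    simp [A, B] at hx hx'
    linarith
  have hAc : IsPreconnected A := by
    rw [show A = ψ '' Metric.ball 0 1 from himg _]
    exact (convex_ball (0 : Plane) 1).isPreconnected.image _ hψ.continuousOn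
  have hBc : IsPreconnected B := by
    rw [show B = ψ '' {y | 1 < ‖y‖} from himg _]
    exact isPreconnected_norm_gt_one.image _ hψ.continuousOn
  have hAb : Bornology.IsBounded A := by
    refine ((isCompact_closedBall (0 : Plane) 1).image hψ).isBounded.subset ?_
    rw [show A = ψ '' Metric.ball 0 1 from himg _]
    exact Set.image_mono Metric.ball_subset_closedBall
  have hBb : ¬ Bornology.IsBounded B := by
    intro hb
    -- If `B` were bounded, its compact closure would have a bounded image containing the exterior
    -- of the unit disk.
    have hcpt : Bornology.IsBounded (φ '' closure B) := (hb.isCompact_closure.image hφ).isBounded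
    have hout : Bornology.IsBounded {y : Plane | 1 < ‖y‖} := hcpt.subset fun y hy =>
      ⟨ψ y, subset_closure (by simpa [B, h2 y] using hy), h2 y⟩
    refine NormedSpace.unbounded_univ ℝ Plane
      ((hout.union (Metric.isBounded_closedBall (x := (0 : Plane)) (r := 1))).subset fun y _ => ?_)
    rcases lt_or_ge 1 ‖y‖ with h | h
    · exact Or.inl h
    · exact Or.inr (by simpa using h)
  have hne : (ψ 0) ∈ A := by simp [A, h2 0]
  ext S
  simp only [boundedComplementComponents, hcompl, Set.mem_ofPred_eq, Set.mem_singleton_iff]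
  constructor
  · rintro ⟨hS, x, hx | hx, rfl⟩
    · exact connectedComponentIn_eq_of_separated hA hB hAB hAc hx
    · rw [Set.union_comm, connectedComponentIn_eq_of_separated hB hA hAB.symm hBc hx] at hS
      exact absurd hS hBb
  · rintro rfl
    exact ⟨hAb, ψ 0, Or.inl hne, (connectedComponentIn_eq_of_separated hA hB hAB hAc hne).symm⟩

lemma interior_preimage_closedBall (hφ : Continuous φ) (hψ : Continuous ψ)
    (h1 : Function.LeftInverse ψ φ) (h2 : Function.RightInverse ψ φ) :
    interior (φ ⁻¹' Metric.closedBall 0 1) = φ ⁻¹' Metric.ball 0 1 := by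
  let Φ : Plane ≃ₜ Plane := ⟨⟨φ, ψ, h1, h2⟩, hφ, hψ⟩
  rw [← interior_closedBall (0 : Plane) one_ne_zero]
  exact (Φ.preimage_interior _).symm

end Transfer

/-! ### Shrinking sublevel sets by the flow of a scaling field. -/

section ScalingFlow

/-- Along a curve following the field `a • W`, where `W` multiplies `g` infinitesimally by `2`
on a closed ball, `g` grows like `exp (2 a t)` as long as this stays below a level of `g` that is
not attained on the boundary sphere. -/
lemma apply_integralCurve_eq {g : Plane → ℝ} {W : Plane → Plane} {δ ε a : ℝ}
    (hg : Differentiable ℝ g) (hgW : ∀ x, ‖x‖ ≤ δ → fderiv ℝ g x (W x) = 2 * g x)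
    (hint : ∀ x, ‖x‖ ≤ δ → g x ≤ ε → ‖x‖ < δ) {u : ℝ → Plane}
    (hu : ∀ t ∈ Set.Icc (0 : ℝ) 1, HasDerivAt u (a • W (u t)) t) (hu0 : ‖u 0‖ ≤ δ)
    (hle : ∀ t ∈ Set.Icc (0 : ℝ) 1, g (u 0) * Real.exp (2 * a * t) ≤ ε) :
    ‖u 1‖ ≤ δ ∧ g (u 1) = g (u 0) * Real.exp (2 * a) := by
  let S : Set ℝ := {t | ‖u t‖ ≤ δ ∧ g (u t) = g (u 0) * Real.exp (2 * a * t)}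
  have huc : ContinuousOn u (Set.Icc 0 1) := fun t ht => (hu t ht).continuousAt.continuousWithinAt
  have hgc := hg.continuous
  -- Continuity argument: the good times form a closed set. It is also open to the right, since by
  -- `hint` the curve is off the boundary sphere as long as `g` is at most `ε`.
  have hclosed : IsClosed (S ∩ Set.Icc 0 1) := by
    have h1 : IsClosed (Set.Icc (0 : ℝ) 1 ∩ (fun t => (‖u t‖, g (u t) - g (u 0) * Real.exp (2 * a * t))) ⁻¹'
        (Set.Iic δ ×ˢ {0})) := by
      refine ContinuousOn.preimage_isClosed_of_isClosed ?_ isClosed_Icc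
        (isClosed_Iic.prod isClosed_singleton)
      exact huc.norm.prodMk ((hgc.comp_continuousOn huc).sub (by fun_prop))
    convert h1 using 1
    ext t
    simp [S, sub_eq_zero, and_comm]
  have hmain : Set.Icc (0 : ℝ) 1 ⊆ S := by
    refine hclosed.Icc_subset_of_forall_mem_nhdsWithin ⟨hu0, by simp⟩ fun t ⟨⟨htδ, htg⟩, ht⟩ => ?_
    have htI : t ∈ Set.Icc (0 : ℝ) 1 := ⟨ht.1, ht.2.le⟩
    have hlt : ‖u t‖ < δ := hint _ htδ (htg ▸ hle t htI)
    have hev : ∀ᶠ s in 𝓝 t, ‖u s‖ < δ := (hu t htI).continuousAt.norm.eventually_lt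
      continuousAt_const hlt
    obtain ⟨η, hη, hball⟩ := Metric.eventually_nhds_iff.1 hev
    let b := min (t + η / 2) 1
    have htb : t < b := lt_min (by linarith) ht.2
    have hIcc : ∀ s ∈ Set.Icc t b, s ∈ Set.Icc (0 : ℝ) 1 ∧ ‖u s‖ < δ := fun s hs => by
      have h1 : s ≤ t + η / 2 := hs.2.trans (min_le_left _ _)
      refine ⟨⟨ht.1.trans hs.1, hs.2.trans (min_le_right _ _)⟩, hball ?_⟩
      rw [Real.dist_eq, abs_of_nonneg (by linarith [hs.1])]
      linarith
    have hder : ∀ s ∈ Set.Icc t b,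
        HasDerivAt (fun s => g (u s) * Real.exp (-(2 * a * s))) 0 s := fun s hs => by
      obtain ⟨hs1, hs2⟩ := hIcc s hs
      have h1 := (hg (u s)).hasFDerivAt.comp_hasDerivAt s (hu s hs1)
      rw [map_smul, hgW _ hs2.le] at h1
      have h2 : HasDerivAt (fun s : ℝ => Real.exp (-(2 * a * s)))
          (Real.exp (-(2 * a * s)) * -(2 * a)) s := by
        simpa using (((hasDerivAt_id s).const_mul (2 * a)).neg).exp
      convert! h1.mul h2 using 1
      simp only [smul_eq_mul, Function.comp]
      ring
    have hconst := constant_of_has_deriv_right_zero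
      (fun s hs => (hder s hs).continuousAt.continuousWithinAt)
      (fun s hs => (hder s ⟨hs.1, hs.2.le⟩).hasDerivWithinAt)
    refine Filter.mem_of_superset (Ioc_mem_nhdsGT htb) fun s hs => ?_
    have hs' : s ∈ Set.Icc t b := ⟨hs.1.le, hs.2⟩
    refine ⟨(hIcc s hs').2.le, ?_⟩
    have h1 := hconst s hs'
    rw [htg, mul_assoc (g (u 0)), ← Real.exp_add, add_neg_cancel, Real.exp_zero, mul_one] at h1
    rw [← h1, mul_assoc, ← Real.exp_add, neg_add_cancel, Real.exp_zero, mul_one]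
  have h1 := hmain (show (1 : ℝ) ∈ Set.Icc (0 : ℝ) 1 by simp)
  simpa [S] using h1

/-- A sublevel set of a function that is multiplied by constants under a flow and has round small
sublevel sets is the image of the unit ball under a diffeomorphism of the plane. -/
lemma exists_diffeo_of_scaling {g : Plane → ℝ} {W : Plane → Plane} {δ ε c η₀ : ℝ} (hε : 0 < ε)
    (hc : 0 < c) (hη₀ : 0 < η₀)
    (hg : Differentiable ℝ g) (hg0 : ∀ x, ‖x‖ ≤ δ → 0 ≤ g x)
    (hW : ContDiff ℝ ∞ W) (hWc : HasCompactSupport W)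
    (hgW : ∀ x, ‖x‖ ≤ δ → fderiv ℝ g x (W x) = 2 * g x)
    (hint : ∀ x, ‖x‖ ≤ δ → g x ≤ ε → ‖x‖ < δ)
    (hround : ∀ η, 0 < η → η < η₀ → ∀ x, (‖x‖ ≤ δ ∧ g x ≤ η) ↔ c * ‖x‖ ^ 2 ≤ η) :
    ∃ φ ψ : Plane → Plane, ContDiff ℝ ∞ φ ∧ ContDiff ℝ ∞ ψ ∧ Function.LeftInverse ψ φ ∧
      Function.RightInverse ψ φ ∧ {x | ‖x‖ ≤ δ ∧ g x ≤ ε} = φ ⁻¹' Metric.closedBall 0 1 := by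
  obtain ⟨C, hC⟩ := hW.lipschitzWith_of_hasCompactSupport hWc (by simp)
  -- Slowing the field down brings its Lipschitz constant below `1`, as `exists_flow_diffeo`
  -- requires.
  let s : NNReal := (C + 1)⁻¹
  have hs : (0 : ℝ) < s := NNReal.coe_pos.2 (by positivity)
  have hsC : s * C < 1 := by
    rw [inv_mul_lt_iff₀ (by positivity), mul_one]
    exact lt_add_one C
  have hWs : LipschitzWith (s * C) fun x => (s : ℝ) • W x := by
    refine LipschitzWith.of_dist_le_mul fun x y => ?_
    rw [dist_smul₀, Real.norm_of_nonneg hs.le, NNReal.coe_mul, mul_assoc]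
    gcongr
    exact hC.dist_le_mul x y
  obtain ⟨φ, ψ, hφ, hψ, hψφ, hφψ, hφu, hψu⟩ :=
    exists_flow_diffeo (W := fun x => (s : ℝ) • W x) (hW.const_smul (s : ℝ)) (hWc.smul_left (f := fun _ => (s : ℝ))) hWs hsC
  let K : ℝ → Set Plane := fun η => {x | ‖x‖ ≤ δ ∧ g x ≤ η}
  -- The factor by which one backward step `ψ` multiplies `g`.
  let q : ℝ := Real.exp (-(2 * s))
  have hq0 : 0 < q := Real.exp_pos _
  have hq1 : q < 1 := by simpa [q] using hs
  have hqi : q * Real.exp (2 * s) = 1 := by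
    rw [← Real.exp_add, neg_add_cancel, Real.exp_zero]
  have hψK : ∀ η, η ≤ ε → ∀ x ∈ K η, ψ x ∈ K (q * η) := by
    rintro η hη x ⟨hx, hgx⟩
    obtain ⟨u, rfl, hu1, hu⟩ := hψu x
    have h := apply_integralCurve_eq (a := -s) hg hgW hint (u := u)
      (fun t ht => by simpa using hu t ht) hx (fun t ht => by
        have h1 : Real.exp (2 * -s * t) ≤ 1 := Real.exp_le_one_iff.2 (by nlinarith [ht.1])
        nlinarith [hg0 _ hx])
    rw [hu1, mul_neg] at h
    refine ⟨h.1, ?_⟩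
    rw [h.2, mul_comm]
    exact mul_le_mul_of_nonneg_left hgx hq0.le
  have hφK : ∀ η, η ≤ ε → ∀ x ∈ K (q * η), φ x ∈ K η := by
    rintro η hη x ⟨hx, hgx⟩
    obtain ⟨u, rfl, hu1, hu⟩ := hφu x
    have hle : g (u 0) * Real.exp (2 * s) ≤ η := by
      calc g (u 0) * Real.exp (2 * s) ≤ q * η * Real.exp (2 * s) := by gcongr
        _ = η := by rw [mul_right_comm, hqi, one_mul]
    have h := apply_integralCurve_eq (a := s) hg hgW hint (u := u) hu hx (fun t ht => by
        have h1 : Real.exp (2 * s * t) ≤ Real.exp (2 * s) :=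
          Real.exp_le_exp.2 (by nlinarith [ht.2])
        exact (mul_le_mul_of_nonneg_left h1 (hg0 _ hx)).trans (hle.trans hη))
    rw [hu1] at h
    exact ⟨h.1, h.2.le.trans hle⟩
  have hstep : ∀ η, η ≤ ε → K η = ψ ⁻¹' K (q * η) := fun η hη => by
    ext x
    exact ⟨hψK η hη x, fun hx => by simpa [hφψ x] using hφK η hη _ hx⟩
  have hiter : ∀ n : ℕ, K ε = ψ^[n] ⁻¹' K (q ^ n * ε) := by
    intro n
    induction n with
    | zero => simp
    | succ n ih =>
      rw [ih, hstep _ (mul_le_of_le_one_left hε.le (pow_le_one₀ hq0.le hq1.le)),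
        ← Set.preimage_comp, ← Function.iterate_succ', pow_succ' q n, mul_assoc]
  -- After enough backward steps the level is below `η₀`, where the sublevel set is a round disk of
  -- radius `√(η / c)`; `ρ` rescales it to the unit disk.
  obtain ⟨n, hn⟩ := exists_pow_lt_of_lt_one (div_pos hη₀ hε) hq1
  rw [lt_div_iff₀ hε] at hn
  set η := q ^ n * ε with hηdef
  have hη : 0 < η := by positivity
  let ρ := Real.sqrt (c / η)
  have hρ : 0 < ρ := Real.sqrt_pos.2 (by positivity)
  have hiterC : ∀ (θ : Plane → Plane), ContDiff ℝ ∞ θ → ∀ n : ℕ, ContDiff ℝ ∞ θ^[n] := by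
    intro θ hθ n
    induction n with
    | zero => exact contDiff_id
    | succ n ih => rw [Function.iterate_succ]; exact ih.comp hθ
  refine ⟨fun x => ρ • ψ^[n] x, fun y => φ^[n] (ρ⁻¹ • y), (hiterC ψ hψ n).const_smul ρ,
    (hiterC φ hφ n).comp (contDiff_id.const_smul ρ⁻¹), fun x => ?_, fun y => ?_, ?_⟩
  · simp only [inv_smul_smul₀ hρ.ne']
    exact (Function.LeftInverse.iterate hφψ n) x
  · simp only []
    rw [(Function.LeftInverse.iterate hψφ n) (ρ⁻¹ • y), smul_inv_smul₀ hρ.ne']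
  · change K ε = _
    rw [hiter n]
    ext x
    simp only [Set.mem_preimage]
    refine (hround η hη hn (ψ^[n] x)).trans ?_
    rw [mem_closedBall_zero_iff, norm_smul, Real.norm_of_nonneg hρ.le,
      ← sq_le_one_iff₀ (by positivity), mul_pow, Real.sq_sqrt (by positivity), div_mul_eq_mul_div,
      div_le_one hη]

end ScalingFlow

/-! ### Construction of the scaling field. -/

section ScalingField

open scoped Gradient

/-- A smooth function that is a multiple of `‖x‖ ^ 2` near the origin and has no other critical
point on a ball admits a compactly supported smooth field `W` with `dg(W) = 2 g`. -/
lemma exists_scaling_field {g : Plane → ℝ} {δ δ' r c : ℝ} (hδ : 0 < δ) (hδδ' : δ < δ')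
    (hr : 0 < r) (hc : 0 < c) (hg : ContDiff ℝ ∞ g) (hgr : ∀ x, ‖x‖ < r → g x = c * ‖x‖ ^ 2)
    (hcrit : ∀ x, x ≠ 0 → ‖x‖ < δ' → ∇ g x ≠ 0) :
    ∃ W : Plane → Plane, ContDiff ℝ ∞ W ∧ HasCompactSupport W ∧
      ∀ x, ‖x‖ ≤ δ → fderiv ℝ g x (W x) = 2 * g x := by
  let b : ContDiffBump (0 : Plane) := ⟨δ, (δ + δ') / 2, hδ, by linarith⟩
  have hgrad : ContDiff ℝ ∞ (∇ g) :=
    (InnerProductSpace.toDual ℝ Plane).symm.contDiff.comp (hg.fderiv_right (m := ∞) (by simp))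
  -- The formula is singular at the critical point `0`, but where `g = c * ‖x‖ ^ 2` it is the
  -- identity field, hence smooth there.
  let w : Plane → Plane := fun x => (2 * g x / ‖∇ g x‖ ^ 2) • ∇ g x
  have hnear : ∀ x, ‖x‖ < r → ∇ g x = (2 * c) • x := by
    intro x hx
    have h1 : HasFDerivAt (fun x : Plane => c * ‖x‖ ^ 2) (c • (2 • innerSL ℝ x)) x :=
      (hasStrictFDerivAt_norm_sq x).hasFDerivAt.const_mul c
    have h2 : HasGradientAt (fun x : Plane => c * ‖x‖ ^ 2) ((2 * c) • x) x := by
      rw [hasGradientAt_iff_hasFDerivAt]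
      convert! h1 using 1
      ext v
      simp
      ring
    have h3 : g =ᶠ[𝓝 x] fun x => c * ‖x‖ ^ 2 := by
      filter_upwards [(isOpen_lt continuous_norm continuous_const).mem_nhds hx] with y hy
      exact hgr y hy
    exact (h2.congr_of_eventuallyEq h3).gradient
  have hw : ∀ x, ‖x‖ < r → w x = x := by
    intro x hx
    by_cases h0 : x = 0
    · simp [w, h0, hnear 0 (by simpa using hr)]
    have hn : ‖x‖ ≠ 0 := norm_ne_zero_iff.2 h0
    simp only [w, hnear x hx, hgr x hx, norm_smul, smul_smul]
    rw [Real.norm_of_nonneg (by positivity)]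
    have : 2 * (c * ‖x‖ ^ 2) / (2 * c * ‖x‖) ^ 2 * (2 * c) = 1 := by field_simp
    rw [this, one_smul]
  refine ⟨fun x => b x • w x, ?_, ?_, ?_⟩
  · rw [contDiff_iff_contDiffAt]
    intro x
    rcases lt_or_ge ‖x‖ r with hx | hx
    · have h : (fun y => b y • w y) =ᶠ[𝓝 x] fun y => b y • y := by
        filter_upwards [(isOpen_lt continuous_norm continuous_const).mem_nhds hx] with y hy
        rw [hw y hy]
      exact ContDiffAt.congr_of_eventuallyEq (b.contDiffAt.smul contDiffAt_id) h
    rcases lt_or_ge ‖x‖ δ' with hx' | hx'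
    · have h0 : x ≠ 0 := by
        rw [← norm_pos_iff]; linarith
      refine b.contDiffAt.smul (ContDiffAt.smul (ContDiffAt.div ?_ ?_ ?_) hgrad.contDiffAt)
      · exact contDiffAt_const.mul hg.contDiffAt
      · exact hgrad.contDiffAt.norm_sq ℝ
      · have := norm_pos_iff.2 (hcrit x h0 hx')
        positivity
    · have h : (fun y => b y • w y) =ᶠ[𝓝 x] fun _ => 0 := by
        have hx2 : (δ + δ') / 2 < ‖x‖ := by linarith
        filter_upwards [(isOpen_lt continuous_const continuous_norm).mem_nhds hx2] with y hy
        have hy' : (δ + δ') / 2 < ‖y‖ := hy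
        rw [b.zero_of_le_dist (by rw [dist_zero_right]; exact hy'.le), zero_smul]
      exact ContDiffAt.congr_of_eventuallyEq contDiffAt_const h
  · exact b.hasCompactSupport.smul_right
  · intro x hx
    have hb : b x = 1 := b.one_of_mem_closedBall (by simpa using hx)
    have hinner : ∀ v, fderiv ℝ g x v = inner ℝ (∇ g x) v := fun v => by
      rw [← toDual_gradient]; rfl
    simp only [hb, one_smul, hinner, w, inner_smul_right, real_inner_self_eq_norm_sq]
    by_cases h0 : x = 0
    · have : g 0 = 0 := by simpa using hgr 0 (by simpa using hr)
      simp [h0, this]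
    · have := norm_ne_zero_iff.2 (hcrit x h0 (hx.trans_lt hδδ'))
      field_simp

end ScalingField

/-! ### Rounding the bottom without creating critical points. -/

section RoundedBottom

open scoped Gradient

/-- Radial cutoff equal to `1` for `‖x‖ ≤ r / 2` and to `0` for `‖x‖ ≥ r`. -/
noncomputable def radialCutoff (r : ℝ) (x : Plane) : ℝ :=
  -- The denominator is `r ^ 2 - (r / 2) ^ 2`.
  Real.smoothTransition ((r ^ 2 - ‖x‖ ^ 2) / (3 / 4 * r ^ 2))

/-- The function `f` with its bottom replaced by the paraboloid `c * ‖x‖ ^ 2` near the origin. -/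
noncomputable def roundedBottom (f : Plane → ℝ) (r c : ℝ) (x : Plane) : ℝ :=
  f x + radialCutoff r x * (c * ‖x‖ ^ 2 - f x)

lemma radialCutoff_nonneg (r : ℝ) (x : Plane) : 0 ≤ radialCutoff r x :=
  Real.smoothTransition.nonneg _

lemma radialCutoff_le_one (r : ℝ) (x : Plane) : radialCutoff r x ≤ 1 :=
  Real.smoothTransition.le_one _

lemma contDiff_radialCutoff (r : ℝ) : ContDiff ℝ ∞ (radialCutoff r) :=
  Real.smoothTransition.contDiff.comp
    ((contDiff_const.sub (contDiff_norm_sq ℝ)).div_const _)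

lemma radialCutoff_eq_one {r : ℝ} (hr : 0 < r) {x : Plane} (hx : ‖x‖ ≤ r / 2) :
    radialCutoff r x = 1 := by
  refine Real.smoothTransition.one_of_one_le ?_
  rw [one_le_div (by positivity)]
  nlinarith [norm_nonneg x]

lemma radialCutoff_eq_zero {r : ℝ} (hr : 0 < r) {x : Plane} (hx : r ≤ ‖x‖) :
    radialCutoff r x = 0 := by
  refine Real.smoothTransition.zero_of_nonpos (div_nonpos_of_nonpos_of_nonneg ?_ (by positivity))
  nlinarith [norm_nonneg x]

/-- Only the inward direction of the gradient and its support in the annulus matter later, so its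
size is hidden in `b`. -/
lemma hasFDerivAt_radialCutoff {r : ℝ} (hr : 0 < r) (x : Plane) :
    ∃ b : ℝ, 0 ≤ b ∧ (b ≠ 0 → r / 2 ≤ ‖x‖ ∧ ‖x‖ ≤ r) ∧
      HasFDerivAt (radialCutoff r) (innerSL ℝ (-b • x)) x := by
  let y : ℝ := (r ^ 2 - ‖x‖ ^ 2) / (3 / 4 * r ^ 2)
  let τ : ℝ := deriv Real.smoothTransition y
  have hτ : 0 ≤ τ := Real.smoothTransition.monotone.deriv_nonneg
  refine ⟨2 * τ / (3 / 4 * r ^ 2), by positivity, fun hb => ?_, ?_⟩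
  · by_contra hcon
    apply hb
    suffices τ = 0 by simp [this]
    rw [not_and_or, not_le, not_le] at hcon
    rcases hcon with h | h
    · have hy : 1 < y := by
        rw [one_lt_div (by positivity)]
        nlinarith [norm_nonneg x]
      have : Real.smoothTransition =ᶠ[𝓝 y] fun _ => 1 := by
        filter_upwards [lt_mem_nhds hy] with z hz
        exact Real.smoothTransition.one_of_one_le hz.le
      simp only [τ, this.deriv_eq, deriv_const]
    · have hy : y < 0 := by
        refine div_neg_of_neg_of_pos ?_ (by positivity)
        nlinarith [norm_nonneg x]
      have : Real.smoothTransition =ᶠ[𝓝 y] fun _ => 0 := by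
        filter_upwards [gt_mem_nhds hy] with z hz
        exact Real.smoothTransition.zero_of_nonpos hz.le
      simp only [τ, this.deriv_eq, deriv_const]
  · have h1 : HasDerivAt Real.smoothTransition τ y :=
      (Real.smoothTransition.contDiff (n := 1)).differentiable (by simp) y |>.hasDerivAt
    have h2 := ((hasStrictFDerivAt_norm_sq x).hasFDerivAt.const_sub (r ^ 2)).mul_const
      (3 / 4 * r ^ 2)⁻¹
    have h3 := h1.comp_hasFDerivAt (f := fun z : Plane => (r ^ 2 - ‖z‖ ^ 2) * (3 / 4 * r ^ 2)⁻¹) x h2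
    convert! h3 using 1
    ext v
    simp
    ring

variable {P : MvPolynomial (Fin 2) ℝ} {r c : ℝ}

lemma contDiff_roundedBottom (P : MvPolynomial (Fin 2) ℝ) (r c : ℝ) :
    ContDiff ℝ ∞ (roundedBottom (polyFun P) r c) :=
  (contDiff_polyFun P).add ((contDiff_radialCutoff r).mul
    ((contDiff_const.mul (contDiff_norm_sq ℝ)).sub (contDiff_polyFun P)))

/-- The gradient is a nonnegative combination of `polyGrad P x` and `x`. The cutoff contributes
outwards because the paraboloid lies below `P` on the annulus. -/
lemma gradient_roundedBottom_ne_zero (hr : 0 < r) (hc : 0 < c) {x : Plane}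
    (hcf : r / 2 ≤ ‖x‖ → ‖x‖ ≤ r → c * ‖x‖ ^ 2 ≤ polyFun P x)
    (hP : ∀ a b : ℝ, 0 ≤ a → 0 ≤ b → 0 < a + b → a • polyGrad P x + b • x ≠ 0) :
    ∇ (roundedBottom (polyFun P) r c) x ≠ 0 := by
  obtain ⟨b, hb0, hb, hd⟩ := hasFDerivAt_radialCutoff hr x
  have hgrad : HasGradientAt (roundedBottom (polyFun P) r c)
      ((1 - radialCutoff r x) • polyGrad P x +
        (2 * c * radialCutoff r x + b * (polyFun P x - c * ‖x‖ ^ 2)) • x) x := by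
    rw [hasGradientAt_iff_hasFDerivAt]
    have h1 := (hasFDerivAt_polyFun P x).add
      (hd.mul (((hasStrictFDerivAt_norm_sq x).hasFDerivAt.const_mul c).sub (hasFDerivAt_polyFun P x)))
    convert! h1 using 1
    ext v
    simp
    ring
  rw [hgrad.gradient]
  have h0 := radialCutoff_nonneg r x
  have h1 := radialCutoff_le_one r x
  have h2 : 0 ≤ b * (polyFun P x - c * ‖x‖ ^ 2) := by
    by_cases hb' : b = 0
    · simp [hb']
    · have := hcf (hb hb').1 (hb hb').2
      exact mul_nonneg hb0 (by linarith)
  refine hP _ _ (by linarith) (by positivity) ?_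
  rcases h0.eq_or_lt with h | h
  · rw [← h]; simp; linarith
  · have : 0 < 2 * c * radialCutoff r x := by positivity
    linarith

end RoundedBottom

/-! ### Polynomial sublevel sets and the main theorem. -/

/-- Sublevel sets of a polynomial inside a disk on which the gradient never points towards the
origin are diffeomorphic to the unit disk, through a diffeomorphism of the plane. -/
lemma exists_diffeo_sublevel {P : MvPolynomial (Fin 2) ℝ} {δ δ' ε : ℝ}
    (hzero : polyFun P 0 = 0) (hδ : 0 < δ) (hδδ' : δ < δ') (hε : 0 < ε)
    (hpos : ∀ x : Plane, x ≠ 0 → ‖x‖ < δ' → 0 < polyFun P x)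
    (hP : ∀ x : Plane, x ≠ 0 → ‖x‖ < δ' → ∀ a b : ℝ, 0 ≤ a → 0 ≤ b → 0 < a + b →
      a • polyGrad P x + b • x ≠ 0)
    (hbd : ∀ x : Plane, ‖x‖ = δ → ε < polyFun P x) :
    ∃ φ ψ : Plane → Plane, ContDiff ℝ ∞ φ ∧ ContDiff ℝ ∞ ψ ∧ Function.LeftInverse ψ φ ∧
      Function.RightInverse ψ φ ∧
      {x | ‖x‖ ≤ δ ∧ polyFun P x ≤ ε} = φ ⁻¹' Metric.closedBall 0 1 := by
  have hPc := continuous_polyFun P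
  have hpos' : ∀ x : Plane, ‖x‖ < δ' → 0 ≤ polyFun P x := fun x hx => by
    by_cases h : x = 0
    · rw [h, hzero]
    · exact (hpos x h hx).le
  -- The rounding takes place where `P < ε`, so the sublevel set at height `ε` is unaffected.
  obtain ⟨r, hr, hrδ, hrε⟩ : ∃ r : ℝ, 0 < r ∧ r < δ ∧ ∀ x : Plane, ‖x‖ ≤ r → polyFun P x < ε := by
    have : ∀ᶠ x in 𝓝 (0 : Plane), polyFun P x < ε :=
      hPc.continuousAt.eventually_lt continuousAt_const (by rwa [hzero])
    obtain ⟨η, hη, h⟩ := Metric.eventually_nhds_iff.1 this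
    refine ⟨min (η / 2) (δ / 2), by positivity, (min_le_right _ _).trans_lt (by linarith),
      fun x hx => h ?_⟩
    rw [dist_zero_right]
    have := hx.trans (min_le_left _ _)
    linarith
  have hannulus : ∀ f : Plane → ℝ, Continuous f → (∀ x, x ≠ 0 → ‖x‖ ≤ δ → 0 < f x) →
      ∃ μ : ℝ, 0 < μ ∧ ∀ x, r / 2 ≤ ‖x‖ → ‖x‖ ≤ δ → μ ≤ f x := by
    intro f hf hfpos
    let A : Set Plane := Metric.closedBall 0 δ ∩ {x | r / 2 ≤ ‖x‖}
    have hA : IsCompact A :=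
      (isCompact_closedBall _ _).inter_right (isClosed_le continuous_const continuous_norm)
    have hne : A.Nonempty := ⟨polarPoint δ 0, by simp [norm_polarPoint hδ.le], by
      simp only [Set.mem_ofPred_eq, norm_polarPoint hδ.le]; linarith⟩
    obtain ⟨x₀, ⟨h1, h2⟩, hmin⟩ := hA.exists_isMinOn hne hf.continuousOn
    have h2' : r / 2 ≤ ‖x₀‖ := h2
    refine ⟨f x₀, hfpos x₀ (by rw [← norm_pos_iff]; linarith) (by simpa using h1), fun x hx hx' => ?_⟩
    exact hmin ⟨by simpa using hx', hx⟩
  obtain ⟨μ, hμ, hμP⟩ := hannulus _ hPc fun x h0 hx => hpos x h0 (hx.trans_lt hδδ')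
  -- With this slope `c * ‖x‖ ^ 2 ≤ μ ≤ P` on the annulus `r / 2 ≤ ‖x‖ ≤ r`.
  let c := μ / r ^ 2
  have hc : 0 < c := by positivity
  have hcf : ∀ x : Plane, r / 2 ≤ ‖x‖ → ‖x‖ ≤ r → c * ‖x‖ ^ 2 ≤ polyFun P x := by
    intro x hx hx'
    refine le_trans ?_ (hμP x hx (hx'.trans hrδ.le))
    rw [div_mul_eq_mul_div, div_le_iff₀ (by positivity)]
    gcongr
  have hcε : ∀ x : Plane, ‖x‖ ≤ r → c * ‖x‖ ^ 2 ≤ ε := by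
    intro x hx
    have h1 : ‖polarPoint r 0‖ = r := norm_polarPoint hr.le 0
    have h2 := hcf (polarPoint r 0) (by linarith) h1.le
    have h3 := hrε (polarPoint r 0) h1.le
    rw [h1] at h2
    have h4 : c * ‖x‖ ^ 2 ≤ c * r ^ 2 := by gcongr
    linarith
  set g := roundedBottom (polyFun P) r c with hgdef
  have hg : ContDiff ℝ ∞ g := contDiff_roundedBottom P r c
  have hgr : ∀ x, ‖x‖ ≤ r / 2 → g x = c * ‖x‖ ^ 2 := fun x hx => by
    simp [hgdef, roundedBottom, radialCutoff_eq_one hr hx]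
  have hgf : ∀ x, r ≤ ‖x‖ → g x = polyFun P x := fun x hx => by
    simp [hgdef, roundedBottom, radialCutoff_eq_zero hr hx]
  have hgconv : ∀ x, g x = (1 - radialCutoff r x) * polyFun P x + radialCutoff r x * (c * ‖x‖ ^ 2) :=
    fun x => by simp only [hgdef, roundedBottom]; ring
  have hgpos : ∀ x, x ≠ 0 → ‖x‖ ≤ δ → 0 < g x := fun x h0 hx => by
    have h1 := hpos x h0 (hx.trans_lt hδδ')
    have h2 : 0 < c * ‖x‖ ^ 2 := by have := norm_pos_iff.2 h0; positivity
    rw [hgconv]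
    rcases (radialCutoff_nonneg r x).eq_or_lt with h | h
    · rw [← h]; simpa using h1
    · have := mul_pos h h2
      have := mul_nonneg (sub_nonneg.2 (radialCutoff_le_one r x)) h1.le
      linarith
  have hg0 : ∀ x, ‖x‖ ≤ δ → 0 ≤ g x := fun x hx => by
    by_cases h : x = 0
    · rw [h, hgr 0 (by simp; positivity)]; simp
    · exact (hgpos x h hx).le
  have hsub : ∀ x : Plane, g x ≤ ε ↔ polyFun P x ≤ ε := fun x => by
    rcases le_or_gt r ‖x‖ with h | h
    · rw [hgf x h]
    · refine ⟨fun _ => (hrε x h.le).le, fun _ => ?_⟩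
      have h1 := mul_le_mul_of_nonneg_left (hrε x h.le).le
        (sub_nonneg.2 (radialCutoff_le_one r x))
      have h2 := mul_le_mul_of_nonneg_left (hcε x h.le) (radialCutoff_nonneg r x)
      rw [hgconv]
      linarith
  obtain ⟨W, hW, hWc, hgW⟩ := exists_scaling_field hδ hδδ' (half_pos hr) hc hg
    (fun x hx => hgr x hx.le)
    (fun x h0 hx => gradient_roundedBottom_ne_zero hr hc (hcf x) (hP x h0 hx))
  obtain ⟨ν, hν, hνg⟩ := hannulus g hg.continuous hgpos
  obtain ⟨φ, ψ, h1, h2, h3, h4, h5⟩ := exists_diffeo_of_scaling (g := g) (δ := δ) hε hc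
    -- Below `ν` the sublevel set stays within radius `r / 2`, where `g` is the paraboloid; below `c
    -- * (r / 2) ^ 2` so does the disk `c * ‖x‖ ^ 2 ≤ η`.
    (η₀ := min ν (c * (r / 2) ^ 2)) (by positivity) (hg.differentiable (by simp)) hg0 hW hWc hgW
    (fun x hx hgx => lt_of_le_of_ne hx fun h => by
      have := hbd x h
      have := (hsub x).1 hgx
      linarith)
    (fun η hη hη₀ x => by
      constructor
      · rintro ⟨hx, hgx⟩
        rcases le_or_gt ‖x‖ (r / 2) with h | h
        · rwa [hgr x h] at hgx
        · have := hνg x h.le hx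
          have := hη₀.trans_le (min_le_left _ _)
          linarith
      · intro hx
        have h1 : c * ‖x‖ ^ 2 < c * (r / 2) ^ 2 := hx.trans_lt (hη₀.trans_le (min_le_right _ _))
        have h2 : ‖x‖ < r / 2 := lt_of_pow_lt_pow_left₀ 2 (by positivity)
          (lt_of_mul_lt_mul_left h1 hc.le)
        exact ⟨by linarith, by rwa [hgr x h2.le]⟩)
  refine ⟨φ, ψ, h1, h2, h3, h4, ?_⟩
  rw [← h5]
  ext x
  simp only [Set.mem_ofPred_eq, hsub]

end LevelCurves

open LevelCurves in
theorem mainTheorem6 (P : MvPolynomial (Fin 2) ℝ)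
    (hzero : LevelCurves.polyFun P 0 = 0)
    (hmin : LevelCurves.IsStrictLocalMin (LevelCurves.polyFun P) 0)
    (V : Set LevelCurves.Plane) (hV : V ∈ 𝓝 (0 : LevelCurves.Plane)) :
    ∃ ε₀ : ℝ, 0 < ε₀ ∧ ∀ ε : ℝ, 0 < ε → ε < ε₀ →
      LevelCurves.IsJordanCurve (LevelCurves.levelCurve (LevelCurves.polyFun P) ε) ∧
      LevelCurves.Diffeomorphic (LevelCurves.levelCurve (LevelCurves.polyFun P) ε)
        (Metric.sphere (0 : LevelCurves.Plane) 1) ∧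
      LevelCurves.Diffeomorphic (LevelCurves.levelDisk (LevelCurves.polyFun P) ε)
        (Metric.closedBall (0 : LevelCurves.Plane) 1) ∧
      LevelCurves.levelDisk (LevelCurves.polyFun P) ε ⊆ V ∧
      ∃ B : Set LevelCurves.Plane,
        LevelCurves.boundedComplementComponents
          (LevelCurves.levelCurve (LevelCurves.polyFun P) ε) = {B} ∧
        (0 : LevelCurves.Plane) ∈ B := by
  have hPc := continuous_polyFun P
  have hev := (eventually_polyGrad_combination_ne_zero hzero hmin).and hmin
  rw [eventually_nhdsWithin_iff] at hev
  obtain ⟨δ', hδ', hall⟩ := Metric.eventually_nhds_iff.1 (hev.and hV)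
  let δ := δ' / 2
  have hδ : 0 < δ := half_pos hδ'
  have hδδ' : δ < δ' := half_lt_self hδ'
  have hP : ∀ x : Plane, x ≠ 0 → ‖x‖ < δ' → ∀ a b : ℝ, 0 ≤ a → 0 ≤ b → 0 < a + b →
      a • polyGrad P x + b • x ≠ 0 := fun x h0 hx =>
    ((hall (by simpa using hx)).1 h0).1
  have hpos : ∀ x : Plane, x ≠ 0 → ‖x‖ < δ' → 0 < polyFun P x := fun x h0 hx => by
    simpa [hzero] using ((hall (by simpa using hx)).1 h0).2
  have hpos' : ∀ x : Plane, ‖x‖ < δ' → 0 ≤ polyFun P x := fun x hx => by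
    by_cases h : x = 0
    · rw [h, hzero]
    · exact (hpos x h hx).le
  -- The threshold `ε₀` is the minimum of `P` on the circle of radius `δ`, which lower levels cannot
  -- meet.
  obtain ⟨x₀, hx₀, hx₀min⟩ := (isCompact_sphere (0 : Plane) δ).exists_isMinOn
    ⟨polarPoint δ 0, by simp [norm_polarPoint hδ.le]⟩ hPc.continuousOn
  have hx₀n : ‖x₀‖ = δ := by simpa using hx₀
  refine ⟨polyFun P x₀, hpos x₀ (by rw [← norm_pos_iff, hx₀n]; exact hδ) (by linarith),
    fun ε hε hεε₀ => ?_⟩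
  have hbd : ∀ x : Plane, ‖x‖ = δ → ε < polyFun P x := fun x hx =>
    hεε₀.trans_le (hx₀min (by simpa using hx))
  obtain ⟨φ, ψ, hφ, hψ, h1, h2, hK⟩ := exists_diffeo_sublevel hzero hδ hδδ' hε hpos hP hbd
  have hdisk : levelDisk (polyFun P) ε = φ ⁻¹' Metric.closedBall 0 1 := by
    rw [← hK]
    have h0 : (0 : Plane) ∈ polyFun P ⁻¹' Set.Icc 0 ε := by simp [hzero, hε.le]
    refine Set.Subset.antisymm (fun x hx => ?_) ?_
    -- The level set misses the circle of radius `δ`, so the component of the origin stays inside.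
    -- Conversely the sublevel set in the ball is connected, as the image of a disk.
    · have hsub : levelDisk (polyFun P) ε ⊆ Metric.ball 0 δ := by
        refine isPreconnected_connectedComponentIn.subset_left_of_subset_union Metric.isOpen_ball
          (v := (Metric.closedBall 0 δ)ᶜ) Metric.isClosed_closedBall.isOpen_compl ?_ ?_
          ⟨0, mem_connectedComponentIn h0, by simpa using hδ⟩
        · rw [Set.disjoint_compl_right_iff_subset]
          exact Metric.ball_subset_closedBall
        · intro y hy
          have hyε := (connectedComponentIn_subset _ _ hy).2
          rcases lt_trichotomy ‖y‖ δ with h | h | h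
          · exact Or.inl (by simpa using h)
          · exact absurd hyε (not_le.2 (hbd y h))
          · exact Or.inr (by simpa using h)
      have hxδ : ‖x‖ < δ := by simpa using hsub hx
      exact ⟨hxδ.le, (connectedComponentIn_subset _ _ hx).2⟩
    · refine IsPreconnected.subset_connectedComponentIn ?_ ⟨by simpa using hδ.le, by
        rw [hzero]; exact hε.le⟩ fun x hx => ⟨hpos' x (hx.1.trans_lt hδδ'), hx.2⟩
      rw [hK, ← Set.image_eq_preimage_of_inverse h2 h1]
      exact (convex_closedBall (0 : Plane) 1).isPreconnected.image _ hψ.continuous.continuousOn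
  have hint := interior_preimage_closedBall hφ.continuous hψ.continuous h1 h2
  have hcurve : levelCurve (polyFun P) ε = φ ⁻¹' Metric.sphere 0 1 := by
    rw [levelCurve, hdisk, hint, ← Set.preimage_sdiff, Metric.closedBall_sdiff_ball]
  rw [hcurve, hdisk]
  refine ⟨isJordanCurve_preimage_sphere hψ.continuous h1 h2, diffeomorphic_preimage hφ hψ h1 h2 _,
    diffeomorphic_preimage hφ hψ h1 h2 _, ?_, φ ⁻¹' Metric.ball 0 1,
    boundedComplementComponents_preimage_sphere hφ.continuous hψ.continuous h1 h2, ?_⟩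
  · rw [← hK]
    intro x hx
    exact (hall (by simpa using hx.1.trans_lt hδδ')).2
  · rw [← hint, mem_interior_iff_mem_nhds, ← hK]
    filter_upwards [Metric.ball_mem_nhds (0 : Plane) hδ,
      hPc.continuousAt.eventually_lt continuousAt_const (by rwa [hzero] : polyFun P 0 < ε)] with x hx hxε
    exact ⟨by simpa using (Metric.mem_ball.1 hx).le, hxε.le⟩
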